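/- Graphs are finite and undirected, may be disconnected, may contain loops, and have no multiple edges. For graphs $G,H$ let $\hom(G,H)$ be the number of maps $V(G)\to V(H)$ that send edges to edges. For a prime $p$, a graph is order-$p$ reduced if it has no automorphism of order $p$. A quantum graph $\bar H=\sum_{H\in\mathcal H}\alpha_H H$ over $\mathbb Z_p=\mathbb Z/p\mathbb Z$ is a formal linear combination of finitely many graphs with coefficients in $\mathbb Z_p$; for quantum graphs $\bar G=\sum_G\beta_G G$ and $\bar H$ put $\hom(\bar G,\bar H)=\sum_{G}\sum_{H}\beta_G\,\alpha_H\hom(G,H)\in\mathbb Z_p$. For a fixed graph $H$, the problem $\#_p\mathrm{HomsTo}(H)$ is to compute $\hom(G,H)\bmod p$ for an input graph $G$. For a fixed quantum graph $\bar H$, the problem $\#_p\mathrm{HomsTo}(\bar H)$ is to compute $\hom(\bar G,\bar H)\in\mathbb Z_p$ for an input quantum graph $\bar G$, or, in its restricted form, for an input graph $\bar G=G$. The class $\#_p\mathrm P$ consists of the functions $f\bmod p$ with $f\in\#\mathrm P$, and a problem is $\#_p\mathrm P$-hard if every function in $\#_p\mathrm P$ reduces to it under polynomial-time Turing reductions.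 **Theorem 1.** Let $p$ be a prime and let $\bar H=\sum_{H\in\mathcal H}\alpha_H H$ be a quantum graph with $\mathcal H=\{H_1,\dots,H_r\}$ a finite set of pairwise non-isomorphic order-$p$ reduced graphs and all coefficients $\alpha_H\in\mathbb Z_p^*=\mathbb Z_p\setminus\{0\}$. Then: - if there is a graph $H\in\mathcal H$ such that $\#_p\mathrm{HomsTo}(H)$ is $\#_p\mathrm P$-hard, then $\#_p\mathrm{HomsTo}(\bar H)$ is $\#_p\mathrm P$-hard; - if $\#_p\mathrm{HomsTo}(H)$ is solvable in polynomial time for all $H\in\mathcal H$, then $\#_p\mathrm{HomsTo}(\bar H)$ is solvable in polynomial time. Both assertions hold for either form of $\#_p\mathrm{HomsTo}(\bar H)$: with graphs as inputs and with quantum graphs as inputs. -/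

import Mathlib

open Polynomial

/-! ## Finite graphs, possibly with loops, and homomorphism counts -/

/-- A finite undirected graph with vertex set `Fin n`. Loops are allowed, multiple edges are not.
The graph may be disconnected, and it may be empty. -/
structure FinGraph where
  /-- the number of vertices -/
  n : ℕ
  /-- the adjacency relation -/
  Adj : Fin n → Fin n → Prop
  /-- the graph is undirected -/
  symm : ∀ i j, Adj i j → Adj j i

namespace FinGraph

/-- The number of homomorphisms from `G` to `H`, that is, of maps from the vertices of `G` to the
vertices of `H` that send edges to edges. -/
noncomputable def homCount (G H : FinGraph) : ℕ := Nat.card (G.Adj →r H.Adj)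

/-- Two graphs are isomorphic if a bijection of the vertex sets preserves adjacency in both
directions. -/
def Isomorphic (G H : FinGraph) : Prop := Nonempty (G.Adj ≃r H.Adj)

/-- A graph is order `p` reduced if no element of its automorphism group has order `p`. -/
def OrderReduced (p : ℕ) (G : FinGraph) : Prop := ∀ σ : G.Adj ≃r G.Adj, orderOf σ ≠ p

open Classical in
/-- The adjacency bits of a graph: for `i = 0, 1, …, n - 1` (the rows of the lower triangle of the
adjacency matrix, with its diagonal) and in row `i` for `j = 0, …, i`, whether `i` and `j` are
adjacent. -/
noncomputable def adjBits (G : FinGraph) : List Bool :=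
  (List.finRange G.n).flatMap fun i =>
    List.ofFn fun j : Fin (i.val + 1) => decide (G.Adj i (Fin.castLE i.isLt j))

/-- The encoding of a graph as a bit string: the number of vertices in unary, a separator, and the
lower triangle of the adjacency matrix. -/
noncomputable def code (G : FinGraph) : List Bool :=
  List.replicate G.n true ++ false :: G.adjBits

end FinGraph

/-- A quantum graph over `ℤ/pℤ`: a formal linear combination of finitely many graphs, given as the
list of its terms (coefficient, graph). -/
abbrev QuantumGraph (p : ℕ) : Type := List (ZMod p × FinGraph)

namespace QuantumGraph

variable {p : ℕ}

/-- The value in `ℤ/pℤ` of the number of homomorphisms from a graph `G` to a quantum graph: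
the sum of `α_H * hom(G, H)` over the terms `α_H H`. -/
noncomputable def homsFrom (Hbar : QuantumGraph p) (G : FinGraph) : ZMod p :=
  (Hbar.map fun t => t.1 * (G.homCount t.2 : ZMod p)).sum

/-- The value in `ℤ/pℤ` of the number of homomorphisms between two quantum graphs:
the sum of `β_G * α_H * hom(G, H)` over the terms `β_G G` and `α_H H`. -/
noncomputable def homsFromQuantum (Hbar Gbar : QuantumGraph p) : ZMod p :=
  (Gbar.map fun s => (Hbar.map fun t => s.1 * t.1 * (s.2.homCount t.2 : ZMod p)).sum).sum

end QuantumGraph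

/-! ## Bit strings -/

/-- A residue modulo `p`, written as its representative in `{0, …, p - 1}` in unary. (The modulus
is a constant of every problem below, so this is a string of bounded length.) -/
def residueCode {p : ℕ} (a : ZMod p) : List Bool := List.replicate a.val true

/-- A self-delimiting form of a bit string: every bit is preceded by a `true`, and a `false` marks
the end. -/
def delimited : List Bool → List Bool
  | [] => [false]
  | b :: w => true :: b :: delimited w

/-- The encoding of a quantum graph: for each term its coefficient and its graph, both in
self-delimiting form. -/
noncomputable def QuantumGraph.code {p : ℕ} (Gbar : QuantumGraph p) : List Bool :=
  Gbar.flatMap fun t => delimited (residueCode t.1) ++ delimited t.2.code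

/-- The encoding of a pair of bit strings as one bit string. -/
def pairCode (x : List Bool × List Bool) : List Bool := delimited x.1 ++ x.2

theorem delimited_append_inj {u v x y : List Bool}
    (h : delimited u ++ x = delimited v ++ y) : u = v ∧ x = y := by
  induction u generalizing v with
  | nil => cases v <;> simp_all [delimited]
  | cons a u ih =>
    cases v with
    | nil => simp [delimited] at h
    | cons b v =>
      simp only [delimited, List.cons_append, List.cons.injEq, true_and] at h
      obtain ⟨h1, h2⟩ := ih h.2
      exact ⟨by rw [h.1, h1], h2⟩

theorem pairCode_injective : Function.Injective pairCode := by
  rintro ⟨a, b⟩ ⟨c, d⟩ h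
  obtain ⟨h1, h2⟩ := delimited_append_inj h
  exact Prod.ext h1 h2

theorem replicate_true_append_inj {m n : ℕ} {x y : List Bool}
    (h : List.replicate m true ++ false :: x = List.replicate n true ++ false :: y) :
    m = n ∧ x = y := by
  induction m generalizing n with
  | zero => cases n <;> simp_all [List.replicate_succ]
  | succ m ih =>
    cases n with
    | zero => simp [List.replicate_succ] at h
    | succ n =>
      simp only [List.replicate_succ, List.cons_append, List.cons.injEq, true_and] at h
      obtain ⟨h1, h2⟩ := ih h
      exact ⟨by rw [h1], h2⟩

theorem FinGraph.code_injective : Function.Injective FinGraph.code := by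
  classical
  rintro ⟨n, A, hA⟩ ⟨m, B, hB⟩ h
  obtain ⟨h1, h2⟩ := replicate_true_append_inj h
  dsimp only at h1
  subst h1
  have key : ∀ C : Fin n → Fin n → Prop, ∀ hC : ∀ i j, C i j → C j i,
      FinGraph.adjBits ⟨n, C, hC⟩ =
        ((List.finRange n).flatMap fun i =>
          List.ofFn fun j : Fin (i.val + 1) => (i, Fin.castLE i.isLt j)).map
            fun e => decide (C e.1 e.2) := by
    intro C hC
    simp only [FinGraph.adjBits, List.map_flatMap, List.map_ofFn]
    rfl
  rw [key, key, List.map_inj_left] at h2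
  have low : ∀ i j : Fin n, j ≤ i → (A i j ↔ B i j) := by
    intro i j hij
    have := h2 (i, j) (by
      rw [List.mem_flatMap]
      refine ⟨i, List.mem_finRange i, ?_⟩
      rw [List.mem_ofFn]
      exact ⟨⟨j.val, Nat.lt_succ_of_le hij⟩, rfl⟩)
    simpa using this
  have : A = B := by
    funext i j
    apply propext
    rcases le_total j i with hij | hij
    · exact low i j hij
    · exact ⟨fun h => hB _ _ ((low j i hij).1 (hA _ _ h)), fun h => hA _ _ ((low j i hij).2 (hB _ _ h))⟩
  subst this
  rfl

theorem residueCode_injective {p : ℕ} [NeZero p] :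
    Function.Injective (residueCode : ZMod p → List Bool) := by
  intro a b h
  apply ZMod.val_injective p
  simpa [residueCode] using congrArg List.length h

theorem QuantumGraph.code_injective {p : ℕ} [NeZero p] :
    Function.Injective (QuantumGraph.code : QuantumGraph p → List Bool) := by
  have ne : ∀ w x : List Bool, delimited w ++ x ≠ [] := by
    intro w x
    cases w <;> simp [delimited]
  intro s
  induction s with
  | nil =>
    intro t h
    cases t with
    | nil => rfl
    | cons b t =>
      simp only [QuantumGraph.code, List.flatMap_nil, List.flatMap_cons, List.append_assoc] at h
      exact absurd h.symm (ne _ _)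
  | cons a s ih =>
    intro t h
    cases t with
    | nil =>
      simp only [QuantumGraph.code, List.flatMap_nil, List.flatMap_cons, List.append_assoc] at h
      exact absurd h (ne _ _)
    | cons b t =>
      simp only [QuantumGraph.code, List.flatMap_cons, List.append_assoc] at h
      obtain ⟨h1, h⟩ := delimited_append_inj h
      obtain ⟨h2, h⟩ := delimited_append_inj h
      rw [ih h, Prod.ext (residueCode_injective h1) (FinGraph.code_injective h2)]

/-! ## Computational problems -/

/-- A (function) problem: a type of instances with an encoding as bit strings, and for each
instance the bit string that has to be computed. -/
structure Problem where
  /-- the instances -/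
  Inst : Type
  /-- the encoding of instances -/
  code : Inst → List Bool
  /-- different instances have different codes -/
  code_injective : Function.Injective code
  /-- the required output -/
  sol : Inst → List Bool

/-- What an oracle for a problem answers to a query: the solution, if the query is the code of an
instance, and nothing otherwise. -/
noncomputable def Problem.oracle (P : Problem) (w : List Bool) : Option (List Bool) :=
  (Function.partialInv P.code w).map P.sol

/-! ## Oracle machines: finite control, finitely many stacks of bits

Two stacks make up one Turing tape, so this is a multitape oracle Turing machine, with the usual
count of steps. -/

/-- The instructions of a machine with stacks indexed by `K` and control states `Λ`. -/
inductive Instr (K Λ : Type) where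
  /-- push a bit on stack `k` and go to `next` -/
  | push (k : K) (b : Bool) (next : Λ)
  /-- remove the top bit of stack `k`, if there is one, and go to a state that depends on it -/
  | pop (k : K) (next : Option Bool → Λ)
  /-- consult the oracle and go to `next` -/
  | query (next : Λ)
  /-- stop -/
  | halt

/-- An oracle machine. -/
structure OracleMachine where
  /-- the stacks -/
  K : Type
  /-- there are finitely many stacks -/
  [fintypeK : Fintype K]
  /-- stacks can be told apart -/
  [decidableEqK : DecidableEq K]
  /-- the control states -/
  Λ : Type
  /-- there are finitely many control states -/
  [fintypeΛ : Fintype Λ]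
  /-- the initial control state -/
  start : Λ
  /-- the input stack -/
  inp : K
  /-- the output stack -/
  out : K
  /-- the stack that holds the queries to the oracle -/
  qry : K
  /-- the stack that receives the answers of the oracle -/
  ans : K
  /-- the instruction to be executed in each control state -/
  prog : Λ → Instr K Λ

attribute [instance] OracleMachine.fintypeK OracleMachine.decidableEqK OracleMachine.fintypeΛ

namespace OracleMachine

/-- A configuration: the control state and the contents of the stacks (top first). -/
structure Cfg (M : OracleMachine) where
  /-- the control state -/
  state : M.Λ
  /-- the contents of the stacks -/
  stk : M.K → List Bool

/-- The initial configuration on input `x`: all stacks except the input stack are empty. -/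
def init (M : OracleMachine) (x : List Bool) : M.Cfg where
  state := M.start
  stk := Function.update (fun _ => []) M.inp x

/-- One step with oracle `O`. A halted configuration has no successor, and neither has one that
poses a query that `O` does not answer. A query takes one step: it empties the query stack and
replaces the contents of the answer stack by the answer. -/
def step (M : OracleMachine) (O : List Bool → Option (List Bool)) (c : M.Cfg) : Option M.Cfg :=
  match M.prog c.state with
  | .push k b next => some ⟨next, Function.update c.stk k (b :: c.stk k)⟩
  | .pop k next => some ⟨next (c.stk k).head?, Function.update c.stk k (c.stk k).tail⟩
  | .query next =>
      (O (c.stk M.qry)).map fun a =>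
        ⟨next, Function.update (Function.update c.stk M.qry []) M.ans a⟩
  | .halt => none

/-- The configuration after exactly `t` steps, if there is one. -/
def run (M : OracleMachine) (O : List Bool → Option (List Bool)) : ℕ → M.Cfg → Option M.Cfg
  | 0, c => some c
  | t + 1, c => (M.step O c).bind (M.run O t)

/-- With oracle `O` and input `x`, the machine executes a halt instruction after at most `t` steps,
and then the output stack holds `y`. -/
def OutputsWithin (M : OracleMachine) (O : List Bool → Option (List Bool)) (x y : List Bool)
    (t : ℕ) : Prop :=
  ∃ s ≤ t, ∃ c : M.Cfg,
    M.run O s (M.init x) = some c ∧ M.prog c.state = Instr.halt ∧ c.stk M.out = y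

/-- With oracle `O`, the machine solves the problem `P` in time polynomial in the length of the
encoded instance. -/
def SolvesInPolyTime (M : OracleMachine) (O : List Bool → Option (List Bool)) (P : Problem) :
    Prop :=
  ∃ q : ℕ[X], ∀ i : P.Inst, M.OutputsWithin O (P.code i) (P.sol i) (q.eval (P.code i).length)

end OracleMachine

/-- A problem is solvable in polynomial time if a machine solves it in polynomial time without
consulting an oracle (no query is ever answered). -/
def Problem.PolyTimeSolvable (P : Problem) : Prop :=
  ∃ M : OracleMachine, M.SolvesInPolyTime (fun _ => none) P

/-- Polynomial-time Turing reducibility of `P` to `Q`: with an oracle for `Q`, the problem `P` can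
be solved in polynomial time. -/
def Problem.TuringReduces (P Q : Problem) : Prop :=
  ∃ M : OracleMachine, M.SolvesInPolyTime Q.oracle P

/-! ## The classes `#P` and `#ₚP` -/

/-- The problem of deciding a binary predicate on bit strings. -/
def decisionProblem (R : List Bool → List Bool → Bool) : Problem where
  Inst := List Bool × List Bool
  code := pairCode
  code_injective := pairCode_injective
  sol x := [R x.1 x.2]

/-- The class `#P`: functions that count the witnesses, of length polynomial in the length of the
input, that a polynomial-time verifier accepts. -/
def InSharpP (f : List Bool → ℕ) : Prop :=
  ∃ (R : List Bool → List Bool → Bool) (q : ℕ[X]),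
    (decisionProblem R).PolyTimeSolvable ∧
      ∀ x, f x = Nat.card {y : List Bool // y.length = q.eval x.length ∧ R x y = true}

/-- The problem of computing `f x` modulo `p` for an input string `x`. -/
def modProblem (p : ℕ) (f : List Bool → ℕ) : Problem where
  Inst := List Bool
  code := id
  code_injective := Function.injective_id
  sol x := residueCode (f x : ZMod p)

/-- The class `#ₚP`: the functions `f` modulo `p` with `f` in `#P`. A problem is `#ₚP`-hard if all
of them reduce to it under polynomial-time Turing reductions. -/
def Problem.SharpModHard (p : ℕ) (Q : Problem) : Prop :=
  ∀ f : List Bool → ℕ, InSharpP f → (modProblem p f).TuringReduces Q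

/-! ## The homomorphism counting problems -/

/-- The problem `#HomsTo(H)` modulo `p`. Input: a graph `G`. Output: the number of homomorphisms
from `G` to `H`, modulo `p`. -/
noncomputable def homsTo (p : ℕ) (H : FinGraph) : Problem where
  Inst := FinGraph
  code := FinGraph.code
  code_injective := FinGraph.code_injective
  sol G := residueCode (G.homCount H : ZMod p)

/-- The problem `#HomsTo(H̄)` modulo `p` for a quantum graph `H̄`, with a graph `G` as input. -/
noncomputable def homsToQuantum (p : ℕ) (Hbar : QuantumGraph p) : Problem where
  Inst := FinGraph
  code := FinGraph.code
  code_injective := FinGraph.code_injective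
  sol G := residueCode (Hbar.homsFrom G)

/-- The problem `#HomsTo(H̄)` modulo `p` for a quantum graph `H̄`, with a quantum graph `Ḡ` as
input. -/
noncomputable def quantumHomsToQuantum (p : ℕ) [NeZero p] (Hbar : QuantumGraph p) : Problem where
  Inst := QuantumGraph p
  code := QuantumGraph.code
  code_injective := QuantumGraph.code_injective
  sol Gbar := residueCode (Hbar.homsFromQuantum Gbar)

/-! Hardness. Fix a term `α H` of `H̄`. Suppose a quantum graph `F̄` has `hom(F̄, H) ≠ 0` and
`hom(F̄, T) = 0` for every other target `T` in `H̄`. Since `hom(G ⊔ F, T) = hom(G, T) * hom(F, T)`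
(`FinGraph.homCount_add`), the combination of the values `hom(G ⊔ F, H̄)` with the coefficients of
`F̄` equals `α * hom(F̄, H) * hom(G, H)`, and the nonzero factor can be divided out. As `F̄` does
not depend on `G`, this takes a constant number of oracle calls
(`QuantumGraph.exists_homCount_eq_sum`, `homsTo_turingReduces_homsToQuantum`).

Such an `F̄` is a product, over the other targets `T`, of factors `G_T - hom(G_T, T) * ∅`, where
`G_T` tells `H` from `T` modulo `p`. That `G_T` exists is Lovász's theorem modulo `p`
(`FinGraph.exists_homCount_ne`). If all counts to `H` and `T` agreed, then so would the counts of
injective homomorphisms, by sorting homomorphisms by their kernels. But `inj(H, H) = |Aut H|` is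
nonzero modulo `p` by Cauchy's theorem, and likewise for `T`. Hence there are injective
homomorphisms both ways, and finite graphs with this property are isomorphic.

Tractability. `hom(G, H̄)` is a fixed linear combination of computable values, and linearity in the
first argument extends the algorithm to quantum graphs as inputs.

The machine model is handled by composable program fragments with time bounds. All answers are
residues, of length at most `p`, so composing reductions keeps stack lengths and times polynomial
(`Problem.TuringReduces.exists_solvesInPolyTime`). -/

/-! ## Homomorphism counts determine order `p` reduced graphs modulo `p` -/

section HomCounts

variable {V W : Type} [Finite V] [Finite W]

/-- The number of injective homomorphisms between two relations. -/
noncomputable def injCount {V W : Type} (r : V → V → Prop) (s : W → W → Prop) : ℕ :=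
  Nat.card {f : r →r s // Function.Injective f}

instance finite_relHom (r : V → V → Prop) (s : W → W → Prop) : Finite (r →r s) :=
  Finite.of_injective (fun f : r →r s => (f : V → W)) DFunLike.coe_injective

instance finite_relIso (r : V → V → Prop) (s : W → W → Prop) : Finite (r ≃r s) :=
  Finite.of_injective (fun f : r ≃r s => (f : V → W)) DFunLike.coe_injective

/-- The relation induced on a quotient. -/
def quotRel {V : Type} (r : V → V → Prop) (θ : Setoid V) : Quotient θ → Quotient θ → Prop :=
  Relation.Map r (Quotient.mk θ) (Quotient.mk θ)

/-- Homomorphisms with a given kernel are injective homomorphisms of the quotient. -/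
def kerFiberEquiv {V W : Type} (r : V → V → Prop) (s : W → W → Prop) (θ : Setoid V) :
    {f : r →r s // Setoid.ker f = θ} ≃ {g : quotRel r θ →r s // Function.Injective g} where
  toFun f := ⟨⟨Quotient.lift f.1 fun a b h => by
      have : Setoid.ker f.1 a b := by rw [f.2]; exact h
      exact this, by
      rintro _ _ ⟨a, b, h, rfl, rfl⟩
      exact f.1.map_rel h⟩, by
      rintro ⟨a⟩ ⟨b⟩ h
      refine Quotient.sound ?_
      have : Setoid.ker f.1 a b := h
      rw [f.2] at this
      exact this⟩
  invFun g := ⟨⟨fun v => g.1 (Quotient.mk θ v), fun h => g.1.map_rel ⟨_, _, h, rfl, rfl⟩⟩, by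
      ext a b
      refine ⟨fun h => Quotient.exact (g.2 h), fun h => ?_⟩
      exact congrArg g.1 (Quotient.sound h)⟩
  left_inv f := by ext; rfl
  right_inv g := by
    apply Subtype.ext
    ext ⟨a⟩
    rfl

theorem card_ker_eq_bot {V W : Type} (r : V → V → Prop) (s : W → W → Prop) :
    Nat.card {f : r →r s // Setoid.ker f = ⊥} = injCount r s := by
  unfold injCount
  congr 2
  ext f
  exact (Setoid.injective_iff_ker_bot _).symm

theorem card_relHom_eq_sum (r : V → V → Prop) (s : W → W → Prop) [Fintype (Setoid V)] :
    Nat.card (r →r s) = ∑ θ : Setoid V, Nat.card {f : r →r s // Setoid.ker f = θ} := by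
  rw [← Nat.card_congr (Equiv.sigmaFiberEquiv fun f : r →r s => Setoid.ker f), Nat.card_sigma]

/-- A surjection between finite sets of equal size is injective, and the quotient map is injective
only for the trivial relation. This drives the induction on the number of vertices. -/
theorem card_quotient_lt {θ : Setoid V} (hθ : θ ≠ ⊥) : Nat.card (Quotient θ) < Nat.card V := by
  refine lt_of_le_of_ne (Nat.card_le_card_of_surjective _ (Quotient.mk_surjective (s := θ))) ?_
  intro h
  apply hθ
  have hb := (Nat.bijective_iff_surjective_and_card (Quotient.mk θ)).2
    ⟨Quotient.mk_surjective, h.symm⟩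
  ext a b
  exact ⟨fun h => hb.1 (Quotient.sound h), fun h => by cases h; exact θ.refl _⟩

theorem finite_setoid : Finite (Setoid V) :=
  Finite.of_injective (fun θ : Setoid V => (θ : V → V → Prop)) fun a b h => by
    ext x y
    exact iff_of_eq (congrFun (congrFun h x) y)

theorem symmetric_quotRel {V : Type} {r : V → V → Prop} (hr : ∀ a b, r a b → r b a) (θ : Setoid V) :
    ∀ a b, quotRel r θ a b → quotRel r θ b a := by
  rintro _ _ ⟨a, b, h, rfl, rfl⟩
  exact ⟨b, a, hr _ _ h, rfl, rfl⟩

/-- If two graphs have equal homomorphism counts from all graphs, then also equal counts of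
injective homomorphisms. -/
theorem injCount_eq_of_homCount_eq {p : ℕ} {W' : Type} [Finite W'] {s : W → W → Prop}
    {s' : W' → W' → Prop}
    (h : ∀ (V : Type) [Finite V] (r : V → V → Prop), (∀ a b, r a b → r b a) →
      (Nat.card (r →r s) : ZMod p) = Nat.card (r →r s')) (n : ℕ) :
    ∀ (V : Type) [Finite V] (r : V → V → Prop), Nat.card V = n → (∀ a b, r a b → r b a) →
      (injCount r s : ZMod p) = injCount r s' := by
  induction n using Nat.strong_induction_on with
  | _ n ih =>
    intro V _ r hn hr
    classical
    have := finite_setoid (V := V)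
    have := Fintype.ofFinite (Setoid V)
    have key := h V r hr
    -- The trivial kernel contributes the injective homomorphisms. Every other kernel contributes
    -- injective homomorphisms from a smaller quotient, where induction applies.
    rw [card_relHom_eq_sum, card_relHom_eq_sum, Nat.cast_sum, Nat.cast_sum,
      ← Finset.add_sum_erase _ _ (Finset.mem_univ ⊥), card_ker_eq_bot,
      ← Finset.add_sum_erase _ _ (Finset.mem_univ ⊥), card_ker_eq_bot] at key
    have rest : ∀ θ ∈ Finset.univ.erase (⊥ : Setoid V),
        (Nat.card {f : r →r s // Setoid.ker f = θ} : ZMod p) =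
          Nat.card {f : r →r s' // Setoid.ker f = θ} := by
      intro θ hθ
      rw [Nat.card_congr (kerFiberEquiv r s θ), Nat.card_congr (kerFiberEquiv r s' θ)]
      exact ih _ (hn ▸ card_quotient_lt (Finset.ne_of_mem_erase hθ)) _ _ rfl
        (symmetric_quotRel hr θ)
    rw [Finset.sum_congr rfl rest] at key
    exact add_right_cancel key

/-- An injective endomorphism permutes the finite set of edges, so an edge between images comes from
an edge, whose ends are `a` and `b` by injectivity. -/
theorem rel_of_injective_endo {r : V → V → Prop} (f : r →r r) (hf : Function.Injective f)
    {a b : V} (h : r (f a) (f b)) : r a b := by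
  let φ : {e : V × V // r e.1 e.2} → {e : V × V // r e.1 e.2} :=
    fun e => ⟨(f e.1.1, f e.1.2), f.map_rel e.2⟩
  have hφ : Function.Injective φ := by
    rintro ⟨⟨a, b⟩, h⟩ ⟨⟨c, d⟩, h'⟩ e
    simp only [φ, Subtype.mk.injEq, Prod.mk.injEq] at e ⊢
    exact ⟨hf e.1, hf e.2⟩
  obtain ⟨⟨⟨c, d⟩, hcd⟩, e⟩ := Finite.surjective_of_injective hφ ⟨(f a, f b), h⟩
  simp only [φ, Subtype.mk.injEq, Prod.mk.injEq] at e
  rw [← hf e.1, ← hf e.2]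
  exact hcd

/-- The two injections force equal cardinalities, so `f` is bijective; it reflects edges because the
injective endomorphism `g ∘ f` does. -/
theorem nonempty_relIso_of_injective {r : V → V → Prop} {s : W → W → Prop} (f : r →r s)
    (hf : Function.Injective f) (g : s →r r) (hg : Function.Injective g) :
    Nonempty (r ≃r s) := by
  have hb : Function.Bijective f := (Nat.bijective_iff_injective_and_card f).2
    ⟨hf, le_antisymm (Nat.card_le_card_of_injective _ hf) (Nat.card_le_card_of_injective _ hg)⟩
  refine ⟨⟨Equiv.ofBijective f hb, fun {a b} => ⟨fun h => ?_, fun h => f.map_rel h⟩⟩⟩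
  exact rel_of_injective_endo (g.comp f) (hg.comp hf) (g.map_rel h)

theorem injCount_self (r : V → V → Prop) : injCount r r = Nat.card (r ≃r r) := by
  refine (Nat.card_eq_of_bijective
    (fun σ : r ≃r r => (⟨σ.toRelEmbedding.toRelHom, σ.injective⟩ :
      {f : r →r r // Function.Injective f})) ⟨?_, ?_⟩).symm
  · intro σ τ h
    ext v
    exact DFunLike.congr_fun (congrArg Subtype.val h) v
  · rintro ⟨f, hf⟩
    refine ⟨⟨Equiv.ofBijective f (Finite.injective_iff_bijective.1 hf), fun {a b} =>
      ⟨fun h => rel_of_injective_endo f hf h, fun h => f.map_rel h⟩⟩, ?_⟩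
    rfl

end HomCounts

namespace FinGraph

/-- Injective endomorphisms are automorphisms, and by Cauchy's theorem a prime dividing the order of
the automorphism group is the order of an element. -/
theorem injCount_self_ne_zero {p : ℕ} [Fact p.Prime] {H : FinGraph} (hH : H.OrderReduced p) :
    (injCount H.Adj H.Adj : ZMod p) ≠ 0 := by
  rw [injCount_self, Ne, ZMod.natCast_eq_zero_iff]
  intro h
  obtain ⟨σ, hσ⟩ := exists_prime_orderOf_dvd_card' p h
  exact hH σ hσ

theorem exists_injective_of_injCount_ne_zero {p : ℕ} {V W : Type} {r : V → V → Prop}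
    {s : W → W → Prop} (h : (injCount r s : ZMod p) ≠ 0) :
    ∃ f : r →r s, Function.Injective f := by
  by_contra hne
  apply h
  have : IsEmpty {f : r →r s // Function.Injective f} := ⟨fun f => hne ⟨f.1, f.2⟩⟩
  simp [injCount]

/-- Non-isomorphic order `p` reduced graphs are told apart by a homomorphism count modulo `p`. -/
theorem exists_homCount_ne {p : ℕ} [Fact p.Prime] {H H' : FinGraph} (hH : H.OrderReduced p)
    (hH' : H'.OrderReduced p) (hiso : ¬ H.Isomorphic H') :
    ∃ G : FinGraph, (G.homCount H : ZMod p) ≠ G.homCount H' := by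
  by_contra! hall
  apply hiso
  -- Quotients do not live on `Fin n`, so the equality of counts is transported to arbitrary finite
  -- vertex types.
  have h : ∀ (V : Type) [Finite V] (r : V → V → Prop), (∀ a b, r a b → r b a) →
      (Nat.card (r →r H.Adj) : ZMod p) = Nat.card (r →r H'.Adj) := by
    intro V _ r hr
    let e := Finite.equivFin V
    let G : FinGraph := ⟨Nat.card V, fun i j => r (e.symm i) (e.symm j), fun i j h => hr _ _ h⟩
    let ε : G.Adj ≃r r := ⟨e.symm, Iff.rfl⟩
    have key : ∀ K : FinGraph, Nat.card (r →r K.Adj) = G.homCount K := fun K =>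
      Nat.card_congr
        ⟨fun f => f.comp ε.toRelEmbedding.toRelHom, fun f => f.comp ε.symm.toRelEmbedding.toRelHom,
          fun f => by ext v; exact congrArg _ (congrArg f (ε.apply_symm_apply v)),
          fun f => by ext v; exact congrArg Fin.val (congrArg f (ε.symm_apply_apply v))⟩
    rw [key, key, hall]
  -- `inj(H, H') = inj(H, H) ≠ 0` modulo `p`, and then the same with the roles exchanged.
  obtain ⟨f, hf⟩ := exists_injective_of_injCount_ne_zero (p := p)
    (injCount_eq_of_homCount_eq h _ _ H.Adj rfl H.symm ▸ injCount_self_ne_zero hH)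
  obtain ⟨g, hg⟩ := exists_injective_of_injCount_ne_zero (p := p)
    ((injCount_eq_of_homCount_eq h _ _ H'.Adj rfl H'.symm).symm ▸ injCount_self_ne_zero hH')
  exact nonempty_relIso_of_injective f hf g hg

/-! ## Disjoint unions -/

/-- The disjoint union; the vertices of the second graph come last. -/
def add (G F : FinGraph) : FinGraph where
  n := G.n + F.n
  Adj i j := Sum.LiftRel G.Adj F.Adj (finSumFinEquiv.symm i) (finSumFinEquiv.symm j)
  symm i j h := by
    generalize finSumFinEquiv.symm i = x at *
    generalize finSumFinEquiv.symm j = y at *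
    cases h with
    | inl h => exact .inl (G.symm _ _ h)
    | inr h => exact .inr (F.symm _ _ h)

/-- The graph without vertices. -/
def empty : FinGraph := ⟨0, fun _ _ => False, fun _ _ h => h⟩

theorem homCount_empty (H : FinGraph) : empty.homCount H = 1 := by
  unfold homCount
  have : Unique (empty.Adj →r H.Adj) :=
    { default := ⟨fun v => v.elim0, fun {a} => a.elim0⟩
      uniq := fun f => by ext v; exact v.elim0 }
  exact Nat.card_unique

/-- No edge joins the two parts, so the restrictions to them can be chosen independently. Disjoint
union thereby acts as a product of quantum graphs, with the empty graph as unit. -/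
theorem homCount_add (G F H : FinGraph) :
    (G.add F).homCount H = G.homCount H * F.homCount H := by
  unfold homCount
  rw [← Nat.card_prod]
  refine Nat.card_congr ⟨fun f => (⟨fun v => f (finSumFinEquiv (.inl v)), fun h => f.map_rel ?_⟩,
      ⟨fun v => f (finSumFinEquiv (.inr v)), fun h => f.map_rel ?_⟩),
    fun f => ⟨fun v => Sum.elim f.1 f.2 (finSumFinEquiv.symm v), ?_⟩, ?_, ?_⟩
  · simpa [add] using h
  · simpa [add] using h
  · intro a b h
    change Sum.LiftRel _ _ _ _ at h
    generalize finSumFinEquiv.symm a = x at *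
    generalize finSumFinEquiv.symm b = y at *
    cases h with
    | inl h => exact f.1.map_rel h
    | inr h => exact f.2.map_rel h
  · intro f
    apply DFunLike.ext
    intro v
    obtain ⟨w, rfl⟩ := finSumFinEquiv.surjective v
    cases w <;> simp only [RelHom.coeFn_mk, Equiv.symm_apply_apply, Sum.elim_inl, Sum.elim_inr]
  · rintro ⟨f, g⟩
    apply Prod.ext <;> apply DFunLike.ext <;> intro v <;>
      simp only [RelHom.coeFn_mk, Equiv.symm_apply_apply, Sum.elim_inl, Sum.elim_inr]

open Classical in
/-- The rows of the lower triangle of the adjacency matrix. -/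
noncomputable def row (G : FinGraph) (i : Fin G.n) : List Bool :=
  List.ofFn fun j : Fin (i.val + 1) => decide (G.Adj i (Fin.castLE i.isLt j))

theorem adjBits_eq (G : FinGraph) : G.adjBits = (List.finRange G.n).flatMap G.row := rfl

open Classical in
theorem getElem_row (G : FinGraph) (i : Fin G.n) (j : ℕ) (h : j < (G.row i).length)
    (h' : j < i.val + 1) : (G.row i)[j] = decide (G.Adj i (Fin.castLE i.isLt ⟨j, h'⟩)) := by
  exact List.getElem_ofFn (f := fun j : Fin (i.val + 1) => decide (G.Adj i (Fin.castLE i.isLt j)))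
    (by simpa using h')

theorem finRange_add (m n : ℕ) : List.finRange (m + n) =
    (List.finRange m).map (Fin.castAdd n) ++ (List.finRange n).map (Fin.natAdd m) := by
  apply List.ext_getElem
  · simp
  · intro i h1 h2
    simp only [List.length_finRange] at h1
    rw [List.getElem_append]
    split_ifs with h
    · simp
    · simp at h
      simp [Fin.ext_iff]
      omega

theorem add_adj_castAdd (G F : FinGraph) (i j : Fin G.n) :
    (G.add F).Adj (Fin.castAdd F.n i) (Fin.castAdd F.n j) ↔ G.Adj i j := by
  simp [add]

theorem add_adj_natAdd (G F : FinGraph) (i j : Fin F.n) :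
    (G.add F).Adj (Fin.natAdd G.n i) (Fin.natAdd G.n j) ↔ F.Adj i j := by
  simp [add]

theorem not_add_adj_natAdd_castAdd (G F : FinGraph) (i : Fin F.n) (j : Fin G.n) :
    ¬ (G.add F).Adj (Fin.natAdd G.n i) (Fin.castAdd F.n j) := by
  simp [add]

theorem row_add_castAdd (G F : FinGraph) (i : Fin G.n) :
    (G.add F).row (Fin.castAdd F.n i) = G.row i := by
  classical
  refine congrArg List.ofFn (funext fun j => ?_)
  exact decide_eq_decide.2 (add_adj_castAdd G F i (Fin.castLE i.isLt j))

/-- The vertices of `F` come last and are not adjacent to those of `G`; hence the leading zeros. -/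
theorem row_add_natAdd (G F : FinGraph) (i : Fin F.n) :
    (G.add F).row (Fin.natAdd G.n i) = List.replicate G.n false ++ F.row i := by
  classical
  apply List.ext_getElem
  · simp [row]; omega
  · intro j h1 h2
    have h3 : j < G.n + i.val + 1 := by simpa [row] using h1
    refine (getElem_row (G.add F) (Fin.natAdd G.n i) j h1 h3).trans ?_
    rw [List.getElem_append]
    split_ifs with h
    · rw [List.getElem_replicate, decide_eq_false_iff_not]
      exact not_add_adj_natAdd_castAdd G F i ⟨j, by simpa using h⟩
    · simp only [List.length_replicate, not_lt] at h
      refine Eq.trans ?_ (getElem_row F i _ _ (by simp; omega)).symm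
      refine decide_eq_decide.2 (Iff.trans ?_ (add_adj_natAdd G F i _))
      apply iff_of_eq
      congr 1
      apply Fin.ext
      simp
      omega

/-- With this order of the vertices the bits of `G` stay contiguous and the rest consists of fixed
words and blocks of `G.n` equal bits, which a stack machine can write easily. -/
theorem code_add (G F : FinGraph) :
    (G.add F).code = List.replicate G.n true ++ (List.replicate F.n true ++ (false ::
      (G.adjBits ++ (List.finRange F.n).flatMap fun i => List.replicate G.n false ++ F.row i))) := by
  have h : (G.add F).adjBits =
      G.adjBits ++ (List.finRange F.n).flatMap fun i => List.replicate G.n false ++ F.row i := by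
    rw [adjBits_eq, adjBits_eq]
    have key : ∀ f : Fin (G.n + F.n) → List Bool, (List.finRange (G.n + F.n)).flatMap f =
        ((List.finRange G.n).flatMap fun i => f (Fin.castAdd F.n i)) ++
          (List.finRange F.n).flatMap fun i => f (Fin.natAdd G.n i) := fun f => by
      rw [finRange_add, List.flatMap_append, List.flatMap_map, List.flatMap_map]
    refine (key (G.add F).row).trans ?_
    rw [funext (row_add_castAdd G F), funext (row_add_natAdd G F)]
  rw [code, h]
  change List.replicate (G.n + F.n) true ++ _ = _
  rw [← List.replicate_append_replicate, List.append_assoc]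

end FinGraph

/-! ## Quantum graphs that single out one target -/

namespace QuantumGraph

variable {p : ℕ}

/-- The number of homomorphisms from a quantum graph to a graph. -/
noncomputable def homsInto (Fbar : QuantumGraph p) (H : FinGraph) : ZMod p :=
  (Fbar.map fun t => t.1 * (t.2.homCount H : ZMod p)).sum

theorem homsInto_cons (t : ZMod p × FinGraph) (Fbar : QuantumGraph p) (H : FinGraph) :
    homsInto (t :: Fbar) H = t.1 * (t.2.homCount H : ZMod p) + homsInto Fbar H := by
  simp [homsInto]

theorem homsInto_append (Fbar Gbar : QuantumGraph p) (H : FinGraph) :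
    homsInto (Fbar ++ Gbar) H = homsInto Fbar H + homsInto Gbar H := by
  simp [homsInto]

theorem homsInto_map_add (Fbar : QuantumGraph p) (c : ZMod p) (G H : FinGraph) :
    homsInto (Fbar.map fun t => (c * t.1, t.2.add G)) H =
      c * (G.homCount H : ZMod p) * homsInto Fbar H := by
  induction Fbar with
  | nil => simp [homsInto]
  | cons t Fbar ih =>
    rw [List.map_cons, homsInto_cons, homsInto_cons, ih, FinGraph.homCount_add]
    push_cast
    ring

/-- The witness is the product of the factors `G - hom(G, T) * ∅`. The factor for `T` vanishes at
`T` but not at `H`, and `ZMod p` has no zero divisors. -/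
theorem exists_separating [Fact p.Prime] (H : FinGraph) (Ts : List FinGraph)
    (h : ∀ T ∈ Ts, ∃ G : FinGraph, (G.homCount H : ZMod p) ≠ G.homCount T) :
    ∃ Fbar : QuantumGraph p, homsInto Fbar H ≠ 0 ∧ ∀ T ∈ Ts, homsInto Fbar T = 0 := by
  induction Ts with
  -- The empty product is the empty graph, with count 1 to every target.
  | nil => exact ⟨[(1, FinGraph.empty)], by simp [homsInto, FinGraph.homCount_empty], by simp⟩
  | cons T Ts ih =>
    obtain ⟨Fbar, h1, h2⟩ := ih fun T hT => h T (List.mem_cons_of_mem _ hT)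
    obtain ⟨G, hG⟩ := h T List.mem_cons_self
    have key : ∀ K : FinGraph, homsInto ((Fbar.map fun t => (1 * t.1, t.2.add G)) ++
        Fbar.map fun t => (-(G.homCount T : ZMod p) * t.1, t.2.add FinGraph.empty)) K =
        ((G.homCount K : ZMod p) - (G.homCount T : ZMod p)) * homsInto Fbar K := by
      intro K
      rw [homsInto_append, homsInto_map_add, homsInto_map_add, FinGraph.homCount_empty]
      push_cast
      ring
    refine ⟨(Fbar.map fun t => (1 * t.1, t.2.add G)) ++
        Fbar.map fun t => (-(G.homCount T : ZMod p) * t.1, t.2.add FinGraph.empty), ?_, ?_⟩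
    rotate_left
    · intro K hK
      rw [key]
      rcases List.mem_cons.1 hK with rfl | hK
      · simp
      · rw [h2 K hK, mul_zero]
    · rw [key]
      exact mul_ne_zero (sub_ne_zero.2 hG) h1

/-- Multiplicativity under disjoint union and an exchange of the two sums: attaching `Fbar` rescales
each coefficient of `Hbar` by the count from `Fbar`. -/
theorem sum_homsFrom_add (Fbar Hbar : QuantumGraph p) (G : FinGraph) :
    (Fbar.map fun t => t.1 * homsFrom Hbar (G.add t.2)).sum =
      (Hbar.map fun t => t.1 * homsInto Fbar t.2 * (G.homCount t.2 : ZMod p)).sum := by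
  induction Fbar with
  | nil => simp [homsInto]
  | cons f Fbar ih =>
    rw [List.map_cons, List.sum_cons, ih, homsFrom, ← List.sum_map_mul_left,
      ← List.sum_map_add]
    congr 1
    apply List.map_congr_left
    intro t _
    rw [FinGraph.homCount_add, homsInto_cons]
    push_cast
    ring

/-- Homomorphisms to a term of a quantum graph whose terms are order `p` reduced and pairwise
non-isomorphic are counted by a linear combination of the homomorphisms from disjoint unions with
fixed graphs to the quantum graph. -/
theorem exists_homCount_eq_sum [Fact p.Prime] (Hbar : QuantumGraph p)
    (hcoeff : ∀ t ∈ Hbar, t.1 ≠ 0) (hreduced : ∀ t ∈ Hbar, t.2.OrderReduced p)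
    (hiso : Hbar.Pairwise fun s t => ¬ s.2.Isomorphic t.2) {t : ZMod p × FinGraph}
    (ht : t ∈ Hbar) :
    ∃ Fbar : QuantumGraph p, ∀ G : FinGraph,
      (G.homCount t.2 : ZMod p) = (Fbar.map fun f => f.1 * homsFrom Hbar (G.add f.2)).sum := by
  obtain ⟨A, B, rfl⟩ := List.append_of_mem ht
  have hAB : ∀ s ∈ A ++ B, ¬ t.2.Isomorphic s.2 := by
    intro s hs
    rw [List.pairwise_append, List.pairwise_cons] at hiso
    rcases List.mem_append.1 hs with hs | hs
    -- `Pairwise` speaks of terms in list order only, so for terms before `t` the isomorphism is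
    -- inverted.
    · rintro ⟨e⟩
      exact hiso.2.2 s hs t List.mem_cons_self ⟨e.symm⟩
    · exact hiso.2.1.1 s hs
  have hmem : ∀ s ∈ A ++ B, s ∈ A ++ t :: B := by
    intro s hs
    simp only [List.mem_append, List.mem_cons] at hs ⊢
    tauto
  obtain ⟨Fbar, h1, h2⟩ := exists_separating (p := p) t.2 ((A ++ B).map Prod.snd) (by
    intro T hT
    obtain ⟨s, hs, rfl⟩ := List.mem_map.1 hT
    exact FinGraph.exists_homCount_ne (hreduced t ht) (hreduced s (hmem s hs)) (hAB s hs))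
  have h3 : ∀ s ∈ A ++ B, homsInto Fbar s.2 = 0 := fun s hs => h2 _ (List.mem_map_of_mem hs)
  have hz : ∀ C : QuantumGraph p, (∀ s ∈ C, homsInto Fbar s.2 = 0) → ∀ G : FinGraph,
      (C.map fun t => t.1 * homsInto Fbar t.2 * (G.homCount t.2 : ZMod p)).sum = 0 := by
    intro C hC G
    apply List.sum_eq_zero
    intro x hx
    obtain ⟨s, hs, rfl⟩ := List.mem_map.1 hx
    rw [hC s hs, mul_zero, zero_mul]
  -- All terms but `t` are annihilated; the surviving factor is a unit and is divided out.
  refine ⟨Fbar.map fun f => ((t.1 * homsInto Fbar t.2)⁻¹ * f.1, f.2), fun G => ?_⟩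
  rw [List.map_map]
  change _ = (Fbar.map fun f =>
    (t.1 * homsInto Fbar t.2)⁻¹ * f.1 * homsFrom (A ++ t :: B) (G.add f.2)).sum
  simp only [mul_assoc (t.1 * homsInto Fbar t.2)⁻¹]
  rw [List.sum_map_mul_left, sum_homsFrom_add, List.map_append, List.map_cons, List.sum_append,
    List.sum_cons, hz A fun s hs => h3 s (List.mem_append_left _ hs),
    hz B fun s hs => h3 s (List.mem_append_right _ hs), zero_add, add_zero, ← mul_assoc,
    inv_mul_cancel₀ (mul_ne_zero (hcoeff t ht) h1), one_mul]

end QuantumGraph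

/-! ## Program fragments -/

/-- Contents of stacks. -/
abbrev Stacks (K : Type) : Type := K → List Bool

/-- Renaming of the targets of an instruction. -/
def Instr.map {K Λ Λ' : Type} (h : Λ → Λ') : Instr K Λ → Instr K Λ'
  | .push k b next => .push k b (h next)
  | .pop k next => .pop k fun o => h (next o)
  | .query next => .query (h next)
  | .halt => .halt

/-- The oracle with its query stack and its answer stack. -/
structure OracleEnv (K : Type) where
  /-- the query stack -/
  qry : K
  /-- the answer stack -/
  ans : K
  /-- the oracle -/
  oracle : List Bool → Option (List Bool)

/-- The effect of an instruction. -/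
def Instr.exec {K Λ : Type} [DecidableEq K] (env : OracleEnv K) (i : Instr K Λ) (s : Stacks K) :
    Option (Λ × Stacks K) :=
  match i with
  | .push k b next => some (next, Function.update s k (b :: s k))
  | .pop k next => some (next (s k).head?, Function.update s k (s k).tail)
  | .query next => (env.oracle (s env.qry)).map fun a =>
      (next, Function.update (Function.update s env.qry []) env.ans a)
  | .halt => none

/-- The combinators below only redirect targets, so this turns each step of a component into a step
of the composite. -/
theorem Instr.exec_map {K Λ Λ' : Type} [DecidableEq K] {env : OracleEnv K} {i : Instr K Λ}
    {s s' : Stacks K} {l : Λ} (h : Λ → Λ') (hi : i.exec env s = some (l, s')) :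
    (i.map h).exec env s = some (h l, s') := by
  cases i with
  | push k b next => simp_all [Instr.map, Instr.exec]
  | pop k next => simp_all [Instr.map, Instr.exec]
  | query next =>
    simp only [Instr.map, Instr.exec, Option.map_eq_some_iff, Prod.mk.injEq] at hi ⊢
    obtain ⟨a, h1, h2, h3⟩ := hi
    exact ⟨a, h1, by rw [h2], h3⟩
  | halt => simp [Instr.exec] at hi

/-- A program fragment over the stacks `K`, which is left through one of the exits `E`. -/
structure Frag (K E : Type) where
  /-- the control states -/
  Λ : Type
  /-- there are finitely many control states -/
  [fintypeΛ : Fintype Λ]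
  /-- the initial control state -/
  start : Λ
  /-- the instruction to be executed in each control state -/
  prog : Λ → Instr K (Λ ⊕ E)

attribute [instance] Frag.fintypeΛ

namespace Frag

variable {K E A S : Type}

/-- A single instruction. -/
def instr (i : Instr K E) : Frag K E where
  Λ := Unit
  start := ()
  prog _ := i.map .inr

/-- Run a fragment and continue with a fragment that depends on the exit. -/
def bind [Fintype A] (f : Frag K A) (g : A → Frag K E) : Frag K E where
  Λ := f.Λ ⊕ Σ a, (g a).Λ
  start := .inl f.start
  prog
    | .inl l => (f.prog l).map (Sum.elim (fun l' => .inl (.inl l'))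
        fun a => .inl (.inr ⟨a, (g a).start⟩))
    | .inr ⟨a, l⟩ => ((g a).prog l).map (Sum.elim (fun l' => .inl (.inr ⟨a, l'⟩)) .inr)

/-- Do nothing and leave through a given exit. -/
def ret [Inhabited K] (e : E) : Frag K E :=
  -- Leaving a fragment requires executing an instruction; a push undone by a pop has no net effect
  -- and costs two steps.
  bind (instr (.push default true ())) fun _ => instr (.pop default fun _ => e)

/-- Rename the exits. -/
def mapExit [Inhabited K] [Fintype A] (f : Frag K A) (h : A → E) : Frag K E :=
  bind f fun a => ret (h a)

/-- Run two fragments one after the other. -/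
def seq (f : Frag K Unit) (g : Frag K E) : Frag K E :=
  bind f fun _ => g

/-- Run fragments, starting with `g σ`; the exit `inl σ'` means to go on with `g σ'`, and the
exit `inr e` means to leave. -/
def loop [Fintype S] (g : S → Frag K (S ⊕ E)) (σ : S) : Frag K E where
  Λ := Σ σ, (g σ).Λ
  start := ⟨σ, (g σ).start⟩
  prog | ⟨σ, l⟩ => ((g σ).prog l).map (Sum.elim (fun l' => .inl ⟨σ, l'⟩)
      (Sum.elim (fun σ' => .inl ⟨σ', (g σ').start⟩) .inr))

variable [DecidableEq K]

/-- From a control state and stacks, the fragment is left through the exit `e` with stacks `s'`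
after exactly `t` steps. -/
inductive Steps (env : OracleEnv K) (f : Frag K E) (e : E) (s' : Stacks K) :
    f.Λ → Stacks K → ℕ → Prop
  | exit {l : f.Λ} {s : Stacks K} (h : (f.prog l).exec env s = some (.inr e, s')) :
      Steps env f e s' l s 1
  | next {l l' : f.Λ} {s u : Stacks K} {t : ℕ} (h : (f.prog l).exec env s = some (.inl l', u))
      (h' : Steps env f e s' l' u t) : Steps env f e s' l s (t + 1)

/-- Started with stacks `s`, the fragment is left through the exit `e` with stacks `s'` after at
most `T` steps. -/
def Runs (env : OracleEnv K) (f : Frag K E) (s : Stacks K) (e : E) (s' : Stacks K) (T : ℕ) :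
    Prop :=
  ∃ t ≤ T, Steps env f e s' f.start s t

variable {env : OracleEnv K}

theorem Runs.mono {f : Frag K E} {s s' : Stacks K} {e : E} {T T' : ℕ}
    (h : f.Runs env s e s' T) (hT : T ≤ T') : f.Runs env s e s' T' := by
  obtain ⟨t, ht, h⟩ := h
  exact ⟨t, ht.trans hT, h⟩

theorem Runs.congr {f : Frag K E} {s s' s'' : Stacks K} {e : E} {T : ℕ}
    (h : f.Runs env s e s' T) (hs : s' = s'') : f.Runs env s e s'' T := hs ▸ h

theorem runs_instr {i : Instr K E} {s s' : Stacks K} {e : E} (h : i.exec env s = some (e, s')) :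
    (instr i).Runs env s e s' 1 :=
  ⟨1, le_rfl, .exit (Instr.exec_map _ h)⟩

theorem runs_push (k : K) (b : Bool) (e : E) (s : Stacks K) :
    (instr (.push k b e)).Runs env s e (Function.update s k (b :: s k)) 1 :=
  runs_instr rfl

theorem runs_pop (k : K) (g : Option Bool → E) (s : Stacks K) :
    (instr (.pop k g)).Runs env s (g (s k).head?) (Function.update s k (s k).tail) 1 :=
  runs_instr rfl

theorem runs_query (e : E) {s : Stacks K} {a : List Bool} (h : env.oracle (s env.qry) = some a) :
    (instr (.query e)).Runs env s e
      (Function.update (Function.update s env.qry []) env.ans a) 1 :=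
  runs_instr (by simp [Instr.exec, h])

/-- The exits of `f` lead directly to the start of the chosen continuation, so the bounds add
without overhead. -/
theorem Runs.bind [Fintype A] {f : Frag K A} {g : A → Frag K E} {s s' s'' : Stacks K} {a : A}
    {e : E} {T T' : ℕ} (h : f.Runs env s a s' T) (h' : (g a).Runs env s' e s'' T') :
    (f.bind g).Runs env s e s'' (T + T') := by
  obtain ⟨t', ht', h'⟩ := h'
  have second : ∀ {l : (g a).Λ} {s : Stacks K} {t : ℕ}, Steps env (g a) e s'' l s t →
      Steps env (f.bind g) e s'' (.inr ⟨a, l⟩) s t := by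
    intro l s t h
    induction h with
    | exit h => exact .exit (Instr.exec_map _ h)
    | next h _ ih => exact .next (Instr.exec_map _ h) ih
  have first : ∀ {l : f.Λ} {s : Stacks K} {t : ℕ}, Steps env f a s' l s t →
      Steps env (f.bind g) e s'' (.inl l) s (t + t') := by
    intro l s t h
    induction h with
    | exit h =>
      rw [add_comm]
      exact .next (Instr.exec_map _ h) (second h')
    | next h _ ih =>
      rw [add_right_comm]
      exact .next (Instr.exec_map _ h) ih
  obtain ⟨t, ht, h⟩ := h
  exact ⟨t + t', by omega, first h⟩

theorem runs_ret [Inhabited K] (e : E) (s : Stacks K) :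
    (ret e : Frag K E).Runs env s e s 2 := by
  have h := Runs.bind (g := fun _ => instr (.pop default fun _ => e))
    (runs_push (env := env) default true () s) (runs_pop default (fun _ => e) _)
  simp only [Function.update_self, List.tail_cons, Function.update_idem,
    Function.update_eq_self] at h
  exact h

theorem Runs.mapExit [Inhabited K] [Fintype A] {f : Frag K A} {s s' : Stacks K} {a : A} {T : ℕ}
    (hf : f.Runs env s a s' T) (h : A → E) : (f.mapExit h).Runs env s (h a) s' (T + 2) :=
  hf.bind (g := fun a => ret (h a)) (runs_ret (h a) s')

theorem Runs.seq {f : Frag K Unit} {g : Frag K E} {s s' s'' : Stacks K}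
    {e : E} {T T' : ℕ} (h : f.Runs env s () s' T) (h' : g.Runs env s' e s'' T') :
    (f.seq g).Runs env s e s'' (T + T') :=
  h.bind (g := fun _ => g) h'

theorem Runs.loop_next [Fintype S] {g : S → Frag K (S ⊕ E)} {σ σ' : S} {s s' s'' : Stacks K}
    {e : E} {T T' : ℕ} (h : (g σ).Runs env s (.inl σ') s' T)
    (h' : (loop g σ').Runs env s' e s'' T') : (loop g σ).Runs env s e s'' (T + T') := by
  obtain ⟨t', ht', h'⟩ := h'
  have first : ∀ {l : (g σ).Λ} {s : Stacks K} {t : ℕ}, Steps env (g σ) (.inl σ') s' l s t →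
      Steps env (loop g σ) e s'' ⟨σ, l⟩ s (t + t') := by
    intro l s t h
    induction h with
    | exit h =>
      rw [add_comm]
      refine .next (Instr.exec_map _ h) ?_
      -- The two loops differ only in their initial state, so the remaining run carries over
      -- unchanged.
      have key : ∀ {l : (loop g σ').Λ} {s : Stacks K} {t : ℕ},
          Steps env (loop g σ') e s'' l s t → Steps env (loop g σ) e s'' l s t := by
        intro l s t h
        induction h with
        | exit h => exact .exit h
        | next h _ ih => exact .next h ih
      exact key h'
    | next h _ ih =>
      rw [add_right_comm]
      exact .next (Instr.exec_map _ h) ih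
  obtain ⟨t, ht, h⟩ := h
  exact ⟨t + t', by omega, first h⟩

theorem Runs.loop_exit [Fintype S] {g : S → Frag K (S ⊕ E)} {σ : S} {s s' : Stacks K}
    {e : E} {T : ℕ} (h : (g σ).Runs env s (.inr e) s' T) :
    (loop g σ).Runs env s e s' T := by
  have first : ∀ {l : (g σ).Λ} {s : Stacks K} {t : ℕ}, Steps env (g σ) (.inr e) s' l s t →
      Steps env (loop g σ) e s' ⟨σ, l⟩ s t := by
    intro l s t h
    induction h with
    | exit h => exact .exit (Instr.exec_map _ h)
    | next h _ ih => exact .next (Instr.exec_map _ h) ih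
  obtain ⟨t, ht, h⟩ := h
  exact ⟨t, ht, first h⟩

/-- A fragment as an oracle machine. -/
def toMachine [Fintype K] (f : Frag K Unit) (inp out qry ans : K) : OracleMachine where
  K := K
  Λ := Option f.Λ
  start := some f.start
  inp := inp
  out := out
  qry := qry
  ans := ans
  prog
    | none => .halt
    | some l => (f.prog l).map (Sum.elim some fun _ => none)

theorem outputsWithin_toMachine [Fintype K] {f : Frag K Unit} {x y : List Bool} {s : Stacks K}
    {T : ℕ} (inp out : K) (h : f.Runs env (Function.update (fun _ => []) inp x) () s T)
    (hs : s out = y) :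
    (f.toMachine inp out env.qry env.ans).OutputsWithin env.oracle x y T := by
  have step : ∀ (l : f.Λ) (s : Stacks K) (l' : Option f.Λ) (s' : Stacks K),
      ((f.prog l).map (Sum.elim some fun _ => none)).exec env s = some (l', s') →
      (f.toMachine inp out env.qry env.ans).step env.oracle ⟨some l, s⟩ = some ⟨l', s'⟩ := by
    intro l s l' s' h
    unfold OracleMachine.step toMachine
    dsimp only
    generalize (f.prog l).map (Sum.elim some fun _ => none) = i at *
    cases i with
    | push k b next => simp_all [Instr.exec]
    | pop k next => simp_all [Instr.exec]
    | query next =>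
      simp only [Instr.exec, Option.map_eq_some_iff, Prod.mk.injEq] at h ⊢
      obtain ⟨a, h1, h2, h3⟩ := h
      exact ⟨a, h1, by rw [← h2, ← h3]⟩
    | halt => simp [Instr.exec] at h
  have key : ∀ {l : f.Λ} {u : Stacks K} {t : ℕ}, Steps env f () s l u t →
      (f.toMachine inp out env.qry env.ans).run env.oracle t ⟨some l, u⟩ = some ⟨none, s⟩ := by
    intro l u t h
    induction h with
    | exit h =>
      rw [OracleMachine.run, step _ _ _ _ (Instr.exec_map _ h)]
      rfl
    | next h _ ih =>
      rw [OracleMachine.run, step _ _ _ _ (Instr.exec_map _ h)]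
      exact ih
  obtain ⟨t, ht, h⟩ := h
  exact ⟨t, ht, _, key h, rfl, hs⟩

/-! ## Elementary programs -/

/-- One round of `drain`, after the removal of a bit. -/
def drainBranch [Inhabited K] [Fintype S] (body : S → Bool → Frag K S) (σ : S) :
    Option Bool → Frag K (S ⊕ S)
  | none => ret (.inr σ)
  | some b => (body σ b).mapExit .inl

/-- Remove the top bit of stack `a` repeatedly until it is empty, run a fragment for each bit, and
keep a value in the control. -/
def drain [Inhabited K] [Fintype S] (a : K) (body : S → Bool → Frag K S) : S → Frag K S :=
  loop fun σ => bind (instr (.pop a id)) (drainBranch body σ)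

theorem runs_drain_nil [Inhabited K] [Fintype S] {a : K} {body : S → Bool → Frag K S} {σ : S}
    {s : Stacks K} (h : s a = []) : (drain a body σ).Runs env s σ s 3 := by
  have h1 := runs_pop (env := env) a id s
  rw [h, List.tail_nil, ← h, Function.update_eq_self, h] at h1
  have h2 : (drainBranch body σ none).Runs env s (.inr σ) s 2 := runs_ret _ _
  exact Runs.loop_exit (h1.bind (g := drainBranch body σ) h2)

/-- Besides the body, a round costs one pop and two steps for renaming the exit. -/
theorem Runs.drain_cons [Inhabited K] [Fintype S] {a : K} {body : S → Bool → Frag K S}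
    {σ σ' σ'' : S} {s s' s'' : Stacks K} {b : Bool} {w : List Bool} {T T' : ℕ}
    (h : s a = b :: w) (hb : (body σ b).Runs env (Function.update s a w) σ' s' T)
    (hd : (drain a body σ').Runs env s' σ'' s'' T') :
    (drain a body σ).Runs env s σ'' s'' (T + 3 + T') := by
  have h1 := runs_pop (env := env) a id s
  rw [h, List.tail_cons] at h1
  have h2 : (drainBranch body σ (some b)).Runs env (Function.update s a w) (.inl σ') s' (T + 2) :=
    hb.mapExit Sum.inl
  exact (Runs.loop_next (h1.bind h2) hd).mono (by omega)

/-- Empty a stack. -/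
def clear [Inhabited K] (a : K) : Frag K Unit := drain a (fun _ _ => ret ()) ()

theorem runs_clear [Inhabited K] (a : K) (s : Stacks K) :
    (clear a).Runs env s () (Function.update s a []) (5 * (s a).length + 3) := by
  generalize hw : s a = w
  induction w generalizing s with
  | nil => exact (runs_drain_nil hw).congr (by rw [← hw, Function.update_eq_self])
  | cons b w ih =>
    refine ((runs_ret ()  _).drain_cons hw
      (ih (Function.update s a w) (by simp))).mono ?_ |>.congr (by simp)
    simp only [List.length_cons]
    omega

/-- Move the contents of stack `a` to stack `b`, reversed. -/
def moveRev [Inhabited K] (a b : K) : Frag K Unit :=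
  drain a (fun _ x => instr (.push b x ())) ()

theorem runs_moveRev [Inhabited K] {a b : K} (hab : a ≠ b) (s : Stacks K) :
    (moveRev a b).Runs env s ()
      (Function.update (Function.update s a []) b ((s a).reverse ++ s b))
      (4 * (s a).length + 3) := by
  generalize hw : s a = w
  induction w generalizing s with
  | nil =>
    refine (runs_drain_nil hw).congr ?_
    rw [← hw, Function.update_eq_self, hw]
    simp
  | cons x w ih =>
    refine ((runs_push b x () _).drain_cons hw (ih _ ?_)).mono ?_ |>.congr ?_
    · simp [hab]
    · simp only [List.length_cons]
      omega
    · funext k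
      by_cases hb : k = b
      · subst hb
        simp [hab.symm]
      · by_cases ha : k = a
        · subst ha
          simp [hab]
        · simp [ha, hb]

/-- Empty stack `a`, pushing its bits on stack `b` and the images of its bits on stack `c`. -/
def split [Inhabited K] (a b c : K) (h : Bool → Bool) : Frag K Unit :=
  drain a (fun _ x => bind (instr (.push b x ())) fun _ => instr (.push c (h x) ())) ()

theorem runs_split [Inhabited K] {a b c : K} (hab : a ≠ b) (hac : a ≠ c) (hbc : b ≠ c)
    (h : Bool → Bool) (s : Stacks K) :
    (split a b c h).Runs env s ()
      (Function.update (Function.update (Function.update s a []) b ((s a).reverse ++ s b)) c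
        (((s a).map h).reverse ++ s c)) (5 * (s a).length + 3) := by
  generalize hw : s a = w
  induction w generalizing s with
  | nil =>
    refine (runs_drain_nil hw).congr ?_
    rw [← hw, Function.update_eq_self, hw]
    simp
  | cons x w ih =>
    refine (((runs_push b x () _).bind (runs_push c (h x) () _)).drain_cons hw
      (ih _ ?_)).mono ?_ |>.congr ?_
    · simp [hab, hac]
    · simp only [List.length_cons]
      omega
    · funext k
      by_cases hc : k = c
      · subst hc
        simp [hac.symm, hbc.symm]
      · by_cases hb : k = b
        · subst hb
          simp [hab.symm, hbc]
        · by_cases ha : k = a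
          · subst ha
            simp [hab, hac]
          · simp [ha, hb, hc]

/-- Push a fixed word on a stack. -/
def pushWord [Inhabited K] (k : K) : List Bool → Frag K Unit
  | [] => ret ()
  | b :: w => bind (pushWord k w) fun _ => instr (.push k b ())

theorem runs_pushWord [Inhabited K] (k : K) (w : List Bool) (s : Stacks K) :
    (pushWord k w).Runs env s () (Function.update s k (w ++ s k)) (w.length + 2) := by
  induction w with
  | nil => exact (runs_ret _ _).congr (by simp)
  | cons b w ih => exact ((ih.bind (runs_push _ _ _ _)).congr (by simp)).mono (by simp)

/-- Empty several stacks. -/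
def clearAll [Inhabited K] : List K → Frag K Unit
  | [] => ret ()
  | k :: l => (clear k).seq (clearAll l)

theorem runs_clearAll [Inhabited K] (l : List K) (s s' : Stacks K) {m : ℕ}
    (hm : ∀ k ∈ l, (s k).length ≤ m) (h : ∀ k ∈ l, s' k = []) (h' : ∀ k ∉ l, s' k = s k) :
    (clearAll l).Runs env s () s' (l.length * (5 * m + 3) + 2) := by
  induction l generalizing s with
  | nil =>
    refine ((runs_ret _ _).congr ?_).mono (by simp)
    funext k
    exact (h' k (by simp)).symm
  | cons a l ih =>
    refine ((runs_clear a s).seq (ih _ ?_ ?_ ?_)).mono ?_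
    · intro k hk
      by_cases h : k = a
      · subst h
        simp
      · simp [h, hm k (List.mem_cons_of_mem _ hk)]
    · exact fun k hk => h k (List.mem_cons_of_mem _ hk)
    · intro k hk
      by_cases hka : k = a
      · subst hka
        rw [h k List.mem_cons_self, Function.update_self]
      · rw [Function.update_of_ne hka]
        exact h' k (by simp [hka, hk])
    · have := hm a List.mem_cons_self
      rw [List.length_cons, add_mul]
      omega

/-- Empty a stack, adding its length to a residue. -/
def tally [Inhabited K] {p : ℕ} [NeZero p] (a : K) : ZMod p → Frag K (ZMod p) :=
  drain a fun σ _ => ret (σ + 1)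

/-- The residue is kept in the finite control, so arithmetic modulo the constant `p` takes no stack
operations. -/
theorem runs_tally [Inhabited K] {p : ℕ} [NeZero p] (a : K) (σ : ZMod p) (s : Stacks K) :
    (tally a σ).Runs env s (σ + (s a).length) (Function.update s a [])
      (5 * (s a).length + 3) := by
  generalize hw : s a = w
  induction w generalizing s σ with
  | nil =>
    rw [← hw, Function.update_eq_self, hw]
    have h := runs_drain_nil (env := env) (body := fun (σ : ZMod p) _ => ret (σ + 1)) (σ := σ) hw
    simpa only [List.length_nil, Nat.cast_zero, add_zero, mul_zero, zero_add, tally] using h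
  | cons b w ih =>
    have := ((runs_ret (σ + 1) _).drain_cons hw (ih (σ + 1) (Function.update s a w) (by simp)))
    simp only [Function.update_idem] at this
    rw [List.length_cons, Nat.cast_add, Nat.cast_one, add_comm (w.length : ZMod p), ← add_assoc]
    exact this.mono (by omega)

end Frag

/-! ## Simulation of a machine by a program fragment -/

namespace OracleMachine

open Frag

variable {K : Type} [DecidableEq K] [Inhabited K] (M : OracleMachine)

/-- The simulation of one step; queries are answered by the fragment `sub`. -/
def simStep (ι : M.K → K) (sub : Frag K Unit) (l : M.Λ) : Frag K (M.Λ ⊕ Unit) :=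
  match M.prog l with
  | .push k b next => instr (.push (ι k) b (.inl next))
  | .pop k next => instr (.pop (ι k) fun o => .inl (next o))
  | .query next => sub.mapExit fun _ => .inl next
  | .halt => ret (.inr ())

/-- The simulation of a machine; queries are answered by the fragment `sub`. -/
def sim (ι : M.K → K) (sub : Frag K Unit) (l : M.Λ) : Frag K Unit :=
  loop (M.simStep ι sub) l

/-- A push adds one bit and an answer has at most `B ≤ n` bits. Bounded answers are what makes the
growth at most one bit per step. -/
theorem length_le_of_step {M : OracleMachine} {O : List Bool → Option (List Bool)} {B n : ℕ}
    (hO : ∀ w a, O w = some a → a.length ≤ B) (hB : B ≤ n) {c c' : M.Cfg}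
    (hc : ∀ k, (c.stk k).length ≤ n) (h : M.step O c = some c') :
    ∀ k, (c'.stk k).length ≤ n + 1 := by
  intro j
  have hj := hc j
  unfold step at h
  split at h
  · next k b next _ =>
    simp only [Option.some.injEq] at h
    subst h
    by_cases hk : j = k
    · subst hk
      simpa using hj
    · simp only [Function.update_of_ne hk]
      omega
  · next k next _ =>
    simp only [Option.some.injEq] at h
    subst h
    by_cases hk : j = k
    · subst hk
      simp
      omega
    · simp only [Function.update_of_ne hk]
      omega
  · next next _ =>
    simp only [Option.map_eq_some_iff] at h
    obtain ⟨a, ha, h⟩ := h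
    subst h
    have := hO _ _ ha
    by_cases hk : j = M.ans
    · subst hk
      simp
      omega
    · simp only [Function.update_of_ne hk]
      by_cases hk : j = M.qry
      · subst hk
        simp
      · simp only [Function.update_of_ne hk]
        omega
  · simp at h

/-- `inj` places the stacks of `M` among those of the host, the others being frozen; `hval` and
`hupd` say that reading and writing commute with it. The bound comes from a query: the subroutine
and two steps for its exit. -/
theorem runs_simStep {M : OracleMachine} {env : OracleEnv K}
    {O : List Bool → Option (List Bool)} {ι : M.K → K}
    {sub : Frag K Unit} {inj : Stacks M.K → Stacks K} (hval : ∀ s k, inj s (ι k) = s k)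
    (hupd : ∀ s k v, Function.update (inj s) (ι k) v = inj (Function.update s k v)) {T : ℕ}
    {c c' : M.Cfg} (h : M.step O c = some c')
    (hsub : ∀ a, O (c.stk M.qry) = some a → sub.Runs env (inj c.stk) ()
      (inj (Function.update (Function.update c.stk M.qry []) M.ans a)) T) :
    (M.simStep ι sub c.state).Runs env (inj c.stk) (.inl c'.state) (inj c'.stk) (T + 2) := by
  unfold step at h
  split at h
  · next k b next hi =>
    simp only [Option.some.injEq] at h
    subst h
    unfold simStep
    rw [hi]
    refine ((runs_push _ _ _ _).congr ?_).mono (by omega)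
    rw [hval, hupd]
  · next k next hi =>
    simp only [Option.some.injEq] at h
    subst h
    unfold simStep
    rw [hi]
    have h1 := runs_pop (env := env) (ι k) (fun o => (Sum.inl (next o) : M.Λ ⊕ Unit)) (inj c.stk)
    rw [hval, hupd] at h1
    exact h1.mono (by omega)
  · next next hi =>
    simp only [Option.map_eq_some_iff] at h
    obtain ⟨a, ha, h⟩ := h
    subst h
    unfold simStep
    rw [hi]
    exact (hsub a ha).mapExit _
  · simp at h

/-- The simulation of a halting computation. -/
theorem runs_sim {M : OracleMachine} {env : OracleEnv K}
    {O : List Bool → Option (List Bool)} {ι : M.K → K}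
    {sub : Frag K Unit} {inj : Stacks M.K → Stacks K} (hval : ∀ s k, inj s (ι k) = s k)
    (hupd : ∀ s k v, Function.update (inj s) (ι k) v = inj (Function.update s k v)) {B T m : ℕ}
    (hO : ∀ w a, O w = some a → a.length ≤ B)
    (hsub : ∀ s a, (∀ k, (s k).length ≤ m) → O (s M.qry) = some a → sub.Runs env (inj s) ()
      (inj (Function.update (Function.update s M.qry []) M.ans a)) T) (t : ℕ) :
    ∀ (n : ℕ) (c c' : M.Cfg), B ≤ n → (∀ k, (c.stk k).length ≤ n) → n + t ≤ m →
      M.run O t c = some c' → M.prog c'.state = .halt →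
      (∀ k, (c'.stk k).length ≤ n + t) ∧
        (M.sim ι sub c.state).Runs env (inj c.stk) () (inj c'.stk) (t * (T + 2) + 2) := by
  induction t with
  | zero =>
    intro n c c' hB hc hm hrun hhalt
    simp only [run, Option.some.injEq] at hrun
    subst hrun
    refine ⟨by simpa using hc, (Runs.loop_exit (T := 2) ?_).mono (by omega)⟩
    unfold simStep
    rw [hhalt]
    exact runs_ret _ _
  | succ t ih =>
    intro n c c' hB hc hm hrun hhalt
    rw [run, Option.bind_eq_some_iff] at hrun
    obtain ⟨d, hd, hrun⟩ := hrun
    -- One step raises the length bound by one and leaves one step fewer, so `n + t` is preserved.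
    obtain ⟨h1, h2⟩ := ih (n + 1) d c' (by omega) (length_le_of_step hO hB hc hd) (by omega)
      hrun hhalt
    refine ⟨fun k => (h1 k).trans (by omega), ?_⟩
    have h3 := runs_simStep hval hupd hd fun a ha => hsub c.stk a
      (fun k => (hc k).trans (by omega)) ha
    exact (Runs.loop_next h3 h2).mono (by rw [add_mul]; omega)

/-- Initially only the input stack is nonempty; `x.length + B` bounds its length and also dominates
`B`, as the induction requires. -/
theorem OutputsWithin.runs_sim {M : OracleMachine} {env : OracleEnv K}
    {O : List Bool → Option (List Bool)} {ι : M.K → K}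
    {sub : Frag K Unit} {inj : Stacks M.K → Stacks K} (hval : ∀ s k, inj s (ι k) = s k)
    (hupd : ∀ s k v, Function.update (inj s) (ι k) v = inj (Function.update s k v)) {B T m : ℕ}
    (hO : ∀ w a, O w = some a → a.length ≤ B)
    (hsub : ∀ s a, (∀ k, (s k).length ≤ m) → O (s M.qry) = some a → sub.Runs env (inj s) ()
      (inj (Function.update (Function.update s M.qry []) M.ans a)) T) {x y : List Bool} {t : ℕ}
    (h : M.OutputsWithin O x y t) (hm : x.length + B + t ≤ m) :
    ∃ s : Stacks M.K, s M.out = y ∧ (∀ k, (s k).length ≤ x.length + B + t) ∧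
      (M.sim ι sub M.start).Runs env (inj (Function.update (fun _ => []) M.inp x)) () (inj s)
        (t * (T + 2) + 2) := by
  obtain ⟨t', ht, c, hrun, hhalt, hout⟩ := h
  obtain ⟨h1, h2⟩ := OracleMachine.runs_sim hval hupd hO hsub t' (x.length + B) (M.init x) c
    (by omega) (by
      intro k
      by_cases hk : k = M.inp
      · subst hk
        simp [init]
      · simp [init, hk]) (by omega) hrun hhalt
  exact ⟨c.stk, hout, fun k => (h1 k).trans (by omega), h2.mono (by gcongr)⟩

end OracleMachine

/-! ## Composition of reductions -/

theorem Polynomial.eval_nat_mono (q : ℕ[X]) : Monotone fun n => q.eval n := by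
  intro a b h
  simp only [eval_eq_sum_range]
  gcongr

theorem Problem.oracle_code (Q : Problem) (i : Q.Inst) : Q.oracle (Q.code i) = some (Q.sol i) := by
  have := (Q.code_injective.isPartialInv i (Q.code i)).2 rfl
  rw [oracle, this]
  rfl

theorem Problem.exists_of_oracle_eq_some {Q : Problem} {w a : List Bool}
    (h : Q.oracle w = some a) : ∃ i, Q.code i = w ∧ Q.sol i = a := by
  simp only [oracle, Option.map_eq_some_iff] at h
  obtain ⟨i, h1, h2⟩ := h
  exact ⟨i, (Q.code_injective.isPartialInv i w).1 h1, h2⟩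

section Composition

open Frag

variable (M N : OracleMachine)

instance inhabitedStacksComp : Inhabited (M.K ⊕ N.K ⊕ Unit) := ⟨.inr (.inr ())⟩

/-- The use of the machine `N` as a subroutine that answers the queries of the machine `M`. -/
noncomputable def callSubroutine : Frag (M.K ⊕ N.K ⊕ Unit) Unit :=
  (moveRev (.inl M.qry) (.inr (.inr ()))).seq <|
  (moveRev (.inr (.inr ())) (.inr (.inl N.inp))).seq <|
  (N.sim (fun k => .inr (.inl k)) (instr (.query ())) N.start).seq <|
  (moveRev (.inr (.inl N.out)) (.inr (.inr ()))).seq <|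
  (clearAll ((Finset.univ : Finset N.K).toList.map fun k => .inr (.inl k))).seq <|
  (clear (.inl M.ans)).seq <|
  moveRev (.inr (.inr ())) (.inl M.ans)

variable {M N}

/-- The stacks of `N` are empty before and after the call, so every call starts in the initial
configuration. The spare stack carries the query in and saves the output during the clean-up; each
passage through it reverses a word twice. -/
theorem runs_callSubroutine {O : List Bool → Option (List Bool)} {B t m : ℕ}
    (hO : ∀ w a, O w = some a → a.length ≤ B) {s : Stacks M.K} {y : List Bool}
    (hs : ∀ k, (s k).length ≤ m) (h : N.OutputsWithin O (s M.qry) y t) :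
    (callSubroutine M N).Runs ⟨.inr (.inl N.qry), .inr (.inl N.ans), O⟩
      (Sum.elim s (Sum.elim (fun _ => []) fun _ => [])) ()
      (Sum.elim (Function.update (Function.update s M.qry []) M.ans y)
        (Sum.elim (fun _ => []) fun _ => []))
      (30 * (m + B + t) + 30 + Fintype.card N.K * (5 * (m + B + t) + 3)) := by
  let env : OracleEnv (M.K ⊕ N.K ⊕ Unit) := ⟨.inr (.inl N.qry), .inr (.inl N.ans), O⟩
  obtain ⟨u, hu, hlen, hrun⟩ := h.runs_sim (env := env) (ι := fun k => .inr (.inl k))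
    (sub := instr (.query ())) (T := 1) (m := (s M.qry).length + B + t)
    (inj := fun v => Sum.elim (Function.update s M.qry []) (Sum.elim v fun _ => []))
    (fun _ _ => rfl) (fun _ _ _ => by simp only [Sum.update_elim_inr, Sum.update_elim_inl]) hO
    (fun v a _ ha => (runs_query () ha).congr (by
      simp only [env, Sum.update_elim_inr, Sum.update_elim_inl])) le_rfl
  have hq := hs M.qry
  have hy : y.length ≤ m + B + t := hu ▸ (hlen N.out).trans (by omega)
  have r1 := runs_moveRev (env := env) (a := .inl M.qry) (b := .inr (.inr ())) (by simp)
    (Sum.elim s (Sum.elim (fun _ => []) fun _ => []))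
  simp only [Sum.update_elim_inr, Sum.update_elim_inl, Sum.elim_inl, Sum.elim_inr,
    List.append_nil] at r1
  have r2 := runs_moveRev (env := env) (a := .inr (.inr ())) (b := .inr (.inl N.inp)) (by simp)
    (Sum.elim (Function.update s M.qry [])
      (Sum.elim (fun _ => []) (Function.update (fun _ => []) () (s M.qry).reverse)))
  simp only [Sum.update_elim_inr, Sum.update_elim_inl, Sum.elim_inl, Sum.elim_inr,
    List.append_nil, Function.update_self, List.reverse_reverse, Function.update_idem,
    List.length_reverse, Function.update_eq_self] at r2
  have r4 := runs_moveRev (env := env) (a := .inr (.inl N.out)) (b := .inr (.inr ())) (by simp)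
    (Sum.elim (Function.update s M.qry []) (Sum.elim u fun _ => []))
  simp only [Sum.update_elim_inr, Sum.update_elim_inl, Sum.elim_inl, Sum.elim_inr,
    List.append_nil, hu] at r4
  have r5 := runs_clearAll (env := env) ((Finset.univ : Finset N.K).toList.map
      fun k => (.inr (.inl k) : M.K ⊕ N.K ⊕ Unit))
    (Sum.elim (Function.update s M.qry []) (Sum.elim (Function.update u N.out [])
      (Function.update (fun _ => []) () y.reverse)))
    (Sum.elim (Function.update s M.qry []) (Sum.elim (fun _ => [])
      (Function.update (fun _ => []) () y.reverse))) (m := m + B + t) (by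
    intro k hk
    simp only [List.mem_map] at hk
    obtain ⟨j, -, rfl⟩ := hk
    change (Function.update u N.out [] j).length ≤ _
    by_cases hj : j = N.out
    · rw [hj, Function.update_self]
      exact Nat.zero_le _
    · rw [Function.update_of_ne hj]
      exact (hlen j).trans (by omega)) (by
    intro k hk
    simp only [List.mem_map] at hk
    obtain ⟨j, -, rfl⟩ := hk
    rfl) (by
    rintro (k | k | k) hk
    · rfl
    · simp at hk
    · rfl)
  have r6 := runs_clear (env := env) (.inl M.ans)
    (Sum.elim (Function.update s M.qry []) (Sum.elim (fun _ => [])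
      (Function.update (fun _ => []) () y.reverse)))
  simp only [Sum.update_elim_inl, Sum.elim_inl] at r6
  have r7 := runs_moveRev (env := env) (a := .inr (.inr ())) (b := .inl M.ans) (by simp)
    (Sum.elim (Function.update (Function.update s M.qry []) M.ans []) (Sum.elim (fun _ => [])
      (Function.update (fun _ => []) () y.reverse)))
  simp only [Sum.update_elim_inr, Sum.update_elim_inl, Sum.elim_inl, Sum.elim_inr,
    List.append_nil, Function.update_self, List.reverse_reverse, Function.update_idem,
    List.length_reverse, Function.update_eq_self] at r7
  -- The query stack and the answer stack of `M` may coincide.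
  have ha : (Function.update s M.qry [] M.ans).length ≤ m := by
    by_cases hj : M.ans = M.qry
    · rw [hj]
      simp
    · rw [Function.update_of_ne hj]
      exact hs _
  refine (r1.seq (r2.seq (hrun.seq (r4.seq (r5.seq (r6.seq r7)))))).mono ?_
  simp only [List.length_map, Finset.length_toList, Finset.card_univ]
  omega

/-- A machine that solves `Q` can answer the queries of a reduction to `Q`. -/
theorem Problem.TuringReduces.exists_solvesInPolyTime {P Q : Problem}
    {O : List Bool → Option (List Bool)} {B : ℕ} (hPQ : P.TuringReduces Q)
    (hQ : ∀ i, (Q.sol i).length ≤ B) (hO : ∀ w a, O w = some a → a.length ≤ B)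
    (h : ∃ N : OracleMachine, N.SolvesInPolyTime O Q) :
    ∃ N : OracleMachine, N.SolvesInPolyTime O P := by
  obtain ⟨M, q, hM⟩ := hPQ
  obtain ⟨N, r, hN⟩ := h
  let env : OracleEnv (M.K ⊕ N.K ⊕ Unit) := ⟨.inr (.inl N.qry), .inr (.inl N.ans), O⟩
  -- `m` bounds the stacks of `M`, hence its queries; `r.comp m` then bounds the time of `N` on a
  -- query, and `m'` the stacks of `N`.
  let m : ℕ[X] := X + (B : ℕ[X]) + q
  let m' : ℕ[X] := m + (B : ℕ[X]) + r.comp m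
  refine ⟨(M.sim .inl (callSubroutine M N) M.start).toMachine (.inl M.inp) (.inl M.out)
    env.qry env.ans,
    q * (30 * m' + 30 + (Fintype.card N.K : ℕ[X]) * (5 * m' + 3) + 2) + 2, fun i => ?_⟩
  have hm : m.eval (P.code i).length = (P.code i).length + B + q.eval (P.code i).length := by
    simp [m]
  obtain ⟨s, hs, -, hrun⟩ := (hM i).runs_sim (env := env) (ι := .inl)
    (sub := callSubroutine M N)
    (T := (30 * m' + 30 + (Fintype.card N.K : ℕ[X]) * (5 * m' + 3)).eval (P.code i).length)
    (m := m.eval (P.code i).length) (B := B)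
    (inj := fun v => Sum.elim v (Sum.elim (fun _ => []) fun _ => []))
    (fun _ _ => rfl) (fun _ _ _ => by simp only [Sum.update_elim_inl])
    (fun w a h => by
      obtain ⟨j, -, rfl⟩ := Problem.exists_of_oracle_eq_some h
      exact hQ j)
    (fun v a hv h => by
      obtain ⟨j, hj, rfl⟩ := Problem.exists_of_oracle_eq_some h
      have h1 := hN j
      rw [hj] at h1
      have h2 := runs_callSubroutine (M := M) hO hv h1
      have h3 := r.eval_nat_mono (hv M.qry)
      refine h2.mono ?_
      simp only [m', eval_add, eval_mul, eval_comp, eval_natCast, eval_ofNat, Nat.cast_id]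
      gcongr) hm.ge
  have e : (Function.update (fun _ => []) (.inl M.inp) (P.code i) : Stacks (M.K ⊕ N.K ⊕ Unit)) =
      Sum.elim (Function.update (fun _ => []) M.inp (P.code i))
        (Sum.elim (fun _ => []) fun _ => []) := by
    rw [← Sum.update_elim_inl]
    congr 1
    funext k
    rcases k with k | k | k <;> rfl
  rw [← e] at hrun
  have h := Frag.outputsWithin_toMachine (Sum.inl M.inp) (Sum.inl M.out) hrun hs
  rw [eval_add, eval_mul, eval_add, eval_ofNat]
  exact h

end Composition

/-! ### Residues as outputs of bounded length -/

section Residues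

variable {p : ℕ} [NeZero p]

theorem natCast_length_residueCode (a : ZMod p) : ((residueCode a).length : ZMod p) = a := by
  simp [residueCode]

theorem length_residueCode_le (a : ZMod p) : (residueCode a).length ≤ p := by
  simpa [residueCode] using a.val_lt.le

end Residues

/-! ## Linear combinations of solvable problems -/

section LinearCombination

open Frag

variable (M N : OracleMachine) {p : ℕ} [NeZero p]

instance inhabitedStacksLinComb : Inhabited (M.K ⊕ N.K ⊕ Bool) := ⟨.inr (.inr false)⟩

/-- Compute a linear combination of the outputs of two machines, which never consult the oracle. -/
def linComb (α : ZMod p) : Frag (M.K ⊕ N.K ⊕ Bool) Unit :=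
  (moveRev (.inr (.inr false)) (.inr (.inr true))).seq <|
  (split (.inr (.inr true)) (.inl M.inp) (.inr (.inl N.inp)) id).seq <|
  (M.sim .inl (ret ()) M.start).seq <|
  (N.sim (fun k => .inr (.inl k)) (ret ()) N.start).seq <|
  bind (tally (.inl M.out) (0 : ZMod p)) fun r =>
  bind (tally (.inr (.inl N.out)) (0 : ZMod p)) fun r' =>
  pushWord (.inr (.inr false)) (residueCode (α * r + r'))

variable {M N}

theorem runs_linComb {env : OracleEnv (M.K ⊕ N.K ⊕ Bool)} (α a b : ZMod p) {w : List Bool}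
    {t t' : ℕ} (hM : M.OutputsWithin (fun _ => none) w (residueCode a) t)
    (hN : N.OutputsWithin (fun _ => none) w (residueCode b) t') :
    ∃ s, s (.inr (.inr false)) = residueCode (α * a + b) ∧
      (linComb M N α).Runs env (Function.update (fun _ => []) (.inr (.inr false)) w) () s
        (9 * w.length + 2 * t + 2 * t' + 11 * p + 20) := by
  have hO : ∀ w a : List Bool, (fun _ : List Bool => (none : Option (List Bool))) w = some a →
      a.length ≤ 0 := by simp
  have r1 := runs_moveRev (env := env) (a := .inr (.inr false)) (b := .inr (.inr true)) (by simp)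
    (Sum.elim (fun _ => []) (Sum.elim (fun _ => []) (Function.update (fun _ => []) false w)))
  simp only [Sum.update_elim_inr, Sum.elim_inr, Function.update_self, Function.update_idem,
    Function.update_eq_self, ne_eq, Bool.true_eq_false, not_false_eq_true,
    Function.update_of_ne, List.append_nil] at r1
  have r2 := runs_split (env := env) (a := .inr (.inr true)) (b := .inl M.inp)
    (c := .inr (.inl N.inp)) (by simp) (by simp) (by simp) id
    (Sum.elim (fun _ => []) (Sum.elim (fun _ => [])
      (Function.update (fun _ => []) true w.reverse)))
  simp only [Sum.update_elim_inr, Sum.update_elim_inl, Sum.elim_inr, Sum.elim_inl,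
    Function.update_self, Function.update_idem, Function.update_eq_self, List.append_nil,
    List.reverse_reverse, List.map_id, List.length_reverse] at r2
  obtain ⟨u, hu, -, r3⟩ := hM.runs_sim (env := env) (ι := .inl) (sub := ret ()) (T := 0)
    (inj := fun v => Sum.elim v (Sum.elim (Function.update (fun _ => []) N.inp w) fun _ => []))
    (fun _ _ => rfl) (fun _ _ _ => by simp only [Sum.update_elim_inl]) hO
    (fun _ _ _ h => by simp at h) le_rfl
  obtain ⟨v, hv, -, r4⟩ := hN.runs_sim (env := env) (ι := fun k => .inr (.inl k)) (sub := ret ())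
    (T := 0) (inj := fun v => Sum.elim u (Sum.elim v fun _ => []))
    (fun _ _ => rfl) (fun _ _ _ => by simp only [Sum.update_elim_inr, Sum.update_elim_inl]) hO
    (fun _ _ _ h => by simp at h) le_rfl
  have r5 := runs_tally (env := env) (.inl M.out) (0 : ZMod p)
    (Sum.elim u (Sum.elim v fun _ => []))
  simp only [Sum.update_elim_inl, Sum.elim_inl, hu, natCast_length_residueCode, zero_add] at r5
  have r6 := runs_tally (env := env) (.inr (.inl N.out)) (0 : ZMod p)
    (Sum.elim (Function.update u M.out []) (Sum.elim v fun _ => []))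
  simp only [Sum.update_elim_inl, Sum.update_elim_inr, Sum.elim_inr, Sum.elim_inl, hv,
    natCast_length_residueCode, zero_add] at r6
  have r7 := runs_pushWord (env := env) (.inr (.inr false)) (residueCode (α * a + b))
    (Sum.elim (Function.update u M.out []) (Sum.elim (Function.update v N.out []) fun _ => []))
  simp only [Sum.elim_inr, List.append_nil] at r7
  have e : (Function.update (fun _ => []) (.inr (.inr false)) w : Stacks (M.K ⊕ N.K ⊕ Bool)) =
      Sum.elim (fun _ => []) (Sum.elim (fun _ => []) (Function.update (fun _ => []) false w)) := by
    rw [← Sum.update_elim_inr, ← Sum.update_elim_inr]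
    congr 1
    funext k
    rcases k with k | k | k <;> rfl
  rw [e]
  refine ⟨_, ?_, (r1.seq (r2.seq (r3.seq (r4.seq (r5.bind
    (g := fun r => bind (tally (.inr (.inl N.out)) (0 : ZMod p)) fun r' =>
      pushWord (.inr (.inr false)) (residueCode (α * r + r')))
    (r6.bind (g := fun r' => pushWord (.inr (.inr false)) (residueCode (α * a + r')))
      r7)))))).mono ?_⟩
  · exact Function.update_self ..
  · have h1 := length_residueCode_le a
    have h2 := length_residueCode_le b
    have h3 := length_residueCode_le (α * a + b)
    omega

theorem polyTimeSolvable_linComb {I : Type} {code : I → List Bool} {hc : Function.Injective code}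
    {a b : I → ZMod p} (α : ZMod p)
    (ha : Problem.PolyTimeSolvable ⟨I, code, hc, fun i => residueCode (a i)⟩)
    (hb : Problem.PolyTimeSolvable ⟨I, code, hc, fun i => residueCode (b i)⟩) :
    Problem.PolyTimeSolvable ⟨I, code, hc, fun i => residueCode (α * a i + b i)⟩ := by
  obtain ⟨M, q, hM⟩ := ha
  obtain ⟨N, r, hN⟩ := hb
  let env : OracleEnv (M.K ⊕ N.K ⊕ Bool) := ⟨default, default, fun _ => none⟩
  refine ⟨(linComb M N α).toMachine (.inr (.inr false)) (.inr (.inr false)) env.qry env.ans,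
    9 * X + 2 * q + 2 * r + 11 * (p : ℕ[X]) + 20, fun i => ?_⟩
  obtain ⟨s, hs, hrun⟩ := runs_linComb (env := env) α _ _ (hM i) (hN i)
  simp only [eval_add, eval_mul, eval_ofNat, eval_X, eval_natCast, Nat.cast_id]
  exact outputsWithin_toMachine (Sum.inr (Sum.inr false)) (Sum.inr (Sum.inr false)) hrun hs

/-- The empty word is the unary code of 0, the value of the empty quantum graph. -/
theorem polyTimeSolvable_nil_output {I : Type} {code : I → List Bool}
    {hc : Function.Injective code} :
    Problem.PolyTimeSolvable ⟨I, code, hc, fun _ => []⟩ := by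
  let env : OracleEnv Bool := ⟨true, true, fun _ => none⟩
  refine ⟨(ret () : Frag Bool Unit).toMachine false true env.qry env.ans, 2, fun i => ?_⟩
  rw [eval_ofNat]
  exact outputsWithin_toMachine false true (runs_ret (env := env) () _) (by simp)

end LinearCombination

/-! ## Reductions between the homomorphism counting problems -/

/-! ### Stack layout and self-delimiting words -/

section SixStacks

/-- Six stacks: the input, two working stacks, a temporary stack, queries, and answers. -/
def six (i c r t q a : List Bool) : Stacks (Fin 6) := ![i, c, r, t, q, a]

variable (i c r t q a v : List Bool)

@[simp] theorem six_zero : six i c r t q a 0 = i := rfl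
@[simp] theorem six_one : six i c r t q a 1 = c := rfl
@[simp] theorem six_two : six i c r t q a 2 = r := rfl
@[simp] theorem six_three : six i c r t q a 3 = t := rfl
@[simp] theorem six_four : six i c r t q a 4 = q := rfl
@[simp] theorem six_five : six i c r t q a 5 = a := rfl

@[simp] theorem update_six_zero : Function.update (six i c r t q a) 0 v = six v c r t q a := by
  funext k; fin_cases k <;> rfl
@[simp] theorem update_six_one : Function.update (six i c r t q a) 1 v = six i v r t q a := by
  funext k; fin_cases k <;> rfl
@[simp] theorem update_six_two : Function.update (six i c r t q a) 2 v = six i c v t q a := by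
  funext k; fin_cases k <;> rfl
@[simp] theorem update_six_three : Function.update (six i c r t q a) 3 v = six i c r v q a := by
  funext k; fin_cases k <;> rfl
@[simp] theorem update_six_four : Function.update (six i c r t q a) 4 v = six i c r t v a := by
  funext k; fin_cases k <;> rfl
@[simp] theorem update_six_five : Function.update (six i c r t q a) 5 v = six i c r t q v := by
  funext k; fin_cases k <;> rfl

theorem update_nil_zero : Function.update (fun _ : Fin 6 => ([] : List Bool)) 0 v =
    six v [] [] [] [] [] := by
  funext k; fin_cases k <;> rfl

/-- The oracle with its stacks. -/
def sixEnv (O : List Bool → Option (List Bool)) : OracleEnv (Fin 6) := ⟨4, 5, O⟩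

namespace Frag

theorem runs_query_six {O : List Bool → Option (List Bool)} {E : Type} (e : E)
    {i c r t q a y : List Bool} (h : O q = some y) :
    (instr (.query e)).Runs (sixEnv O) (six i c r t q a) e (six i c r t [] y) 1 :=
  (runs_query (env := sixEnv O) (s := six i c r t q a) (a := y) e h).congr (by simp [sixEnv])

theorem length_delimited (w : List Bool) : (delimited w).length = 2 * w.length + 1 := by
  induction w with
  | nil => rfl
  | cons b w ih =>
    simp only [delimited, List.length_cons, ih]
    omega

/-- Empty the temporary stack and push the self-delimiting form of its reversed contents on the
query stack. -/
def pushDelimited : Frag (Fin 6) Unit :=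
  (instr (.push 4 false ())).seq
    (drain 3 (fun _ b => (instr (.push 4 b ())).seq (instr (.push 4 true ()))) ())

/-- A stack is written from the end of the word: first the terminator, then each bit followed by its
marker, which ends up on top of it. -/
theorem runs_pushDelimited {env : OracleEnv (Fin 6)} (i c r t a : List Bool) :
    pushDelimited.Runs env (six i c r t [] a) () (six i c r [] (delimited t.reverse) a)
      (5 * t.length + 4) := by
  have key : ∀ v : List Bool,
      (drain (3 : Fin 6) (fun _ b => (instr (.push 4 b ())).seq (instr (.push 4 true ()))) ()).Runs
        env (six i c r t (delimited v) a) () (six i c r [] (delimited (t.reverse ++ v)) a)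
        (5 * t.length + 3) := by
    induction t with
    | nil => exact fun v => runs_drain_nil rfl
    | cons b t ih =>
      intro v
      have h1 := runs_push (env := env) (4 : Fin 6) b () (six i c r t (delimited v) a)
      have h2 := runs_push (env := env) (4 : Fin 6) true () (six i c r t (b :: delimited v) a)
      simp only [update_six_four, six_four] at h1 h2
      have h3 := Runs.drain_cons (a := (3 : Fin 6)) (s := six i c r (b :: t) (delimited v) a)
        (σ := ()) (body := fun _ b => (instr (.push 4 b ())).seq (instr (.push 4 true ())))
        (b := b) (w := t) rfl (by simpa [delimited] using h1.seq h2) (ih (b :: v))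
      simp only [List.reverse_cons, List.append_assoc, List.singleton_append]
      exact h3.mono (by simp only [List.length_cons]; omega)
  have h1 := runs_push (env := env) (4 : Fin 6) false () (six i c r t [] a)
  simp only [update_six_four, six_four] at h1
  have h2 := key []
  rw [List.append_nil] at h2
  exact (h1.seq h2).mono (by omega)

end Frag

end SixStacks

open Frag

theorem QuantumGraph.code_singleton_one {p : ℕ} [Fact p.Prime] (G : FinGraph) :
    QuantumGraph.code [((1 : ZMod p), G)] = [true, true, false] ++ delimited G.code := by
  have : Fact (1 < p) := ⟨(Fact.out : p.Prime).one_lt⟩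
  simp [QuantumGraph.code, residueCode, ZMod.val_one, delimited]

/-- Graphs are special quantum graphs. -/
theorem homsToQuantum_turingReduces_quantumHomsToQuantum (p : ℕ) [Fact p.Prime]
    (Hbar : QuantumGraph p) :
    (homsToQuantum p Hbar).TuringReduces (quantumHomsToQuantum p Hbar) := by
  let O := (quantumHomsToQuantum p Hbar).oracle
  let f : Frag (Fin 6) Unit := (moveRev 0 3).seq <| pushDelimited.seq <|
    (pushWord 4 [true, true, false]).seq <| instr (.query ())
  -- The answer stack is the output stack: the answer for `1 * G` is the required value.
  refine ⟨f.toMachine 0 5 (sixEnv O).qry (sixEnv O).ans, 9 * X + 13, fun G : FinGraph => ?_⟩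
  have r1 := runs_moveRev (env := sixEnv O) (a := (0 : Fin 6)) (b := 3) (by decide)
    (six G.code [] [] [] [] [])
  simp only [update_six_zero, update_six_three, six_zero, six_three, List.append_nil] at r1
  have r2 := runs_pushDelimited (env := sixEnv O) [] [] [] G.code.reverse []
  rw [List.reverse_reverse, List.length_reverse] at r2
  have r3 := runs_pushWord (env := sixEnv O) (4 : Fin 6) [true, true, false]
    (six [] [] [] [] (delimited G.code) [])
  rw [update_six_four, six_four, ← QuantumGraph.code_singleton_one (p := p)] at r3
  have r4 := runs_query_six (O := O) () (i := []) (c := []) (r := []) (t := []) (a := [])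
    ((quantumHomsToQuantum p Hbar).oracle_code [((1 : ZMod p), G)])
  have hrun := r1.seq (r2.seq (r3.seq r4))
  rw [← update_nil_zero] at hrun
  have h := outputsWithin_toMachine (f := f) 0 5 (y := (homsToQuantum p Hbar).sol G)
    (hrun.mono (T' := 9 * G.code.length + 13) (by
      simp only [List.length_cons, List.length_nil]
      omega)) (by
      simp [quantumHomsToQuantum, homsToQuantum, QuantumGraph.homsFromQuantum,
        QuantumGraph.homsFrom])
  simp only [eval_add, eval_mul, eval_ofNat, eval_X]
  exact h

/-! ### Evaluation of an input quantum graph, term by term -/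

namespace Frag

variable {env : OracleEnv (Fin 6)}

section Reading

variable {p : ℕ} [NeZero p]

/-- Branching in `readTally`. -/
def readTallyBranch (σ : ZMod p) : Option Bool → Frag (Fin 6) (ZMod p ⊕ Option (ZMod p))
  | none => ret (.inr none)
  | some false => ret (.inr (some σ))
  | some true => instr (.pop 0 fun _ => .inl (σ + 1))

/-- Read a self-delimiting word from the input and add its length to a residue; the exit `none` is
taken at the end of the input. -/
def readTally (σ : ZMod p) : Frag (Fin 6) (Option (ZMod p)) :=
  loop (fun σ => bind (instr (.pop 0 id)) (readTallyBranch σ)) σ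

theorem runs_readTally_nil (σ : ZMod p) (c r t q a : List Bool) :
    (readTally σ).Runs env (six [] c r t q a) none (six [] c r t q a) 3 := by
  have h1 := runs_pop (env := env) (0 : Fin 6) id (six [] c r t q a)
  have h2 : (readTallyBranch σ none).Runs env (six [] c r t q a) (.inr none)
    (six [] c r t q a) 2 := runs_ret _ _
  simp only [update_six_zero, six_zero, List.tail_nil] at h1
  exact Runs.loop_exit (h1.bind (g := readTallyBranch σ) h2)

/-- A coefficient is determined by the length of its unary code, so the data bits are discarded and
only counted. -/
theorem runs_readTally (w x c r t q a : List Bool) (σ : ZMod p) :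
    (readTally σ).Runs env (six (delimited w ++ x) c r t q a) (some (σ + (w.length : ZMod p)))
      (six x c r t q a) (2 * w.length + 3) := by
  induction w generalizing σ with
  | nil =>
    have h1 := runs_pop (env := env) (0 : Fin 6) id (six (false :: x) c r t q a)
    have h2 : (readTallyBranch σ (some false)).Runs env (six x c r t q a) (.inr (some σ))
      (six x c r t q a) 2 := runs_ret _ _
    simp only [update_six_zero, six_zero, List.tail_cons] at h1
    rw [List.length_nil, Nat.cast_zero, add_zero]
    exact Runs.loop_exit (h1.bind (g := readTallyBranch σ) h2)
  | cons b w ih =>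
    have h1 := runs_pop (env := env) (0 : Fin 6) id
      (six (true :: b :: (delimited w ++ x)) c r t q a)
    have h2 : (readTallyBranch σ (some true)).Runs env (six (b :: (delimited w ++ x)) c r t q a)
        (.inl (σ + 1)) (six (delimited w ++ x) c r t q a) 1 :=
      (runs_pop _ _ _).congr (by simp)
    simp only [update_six_zero, six_zero, List.tail_cons] at h1
    have h3 := Runs.loop_next (h1.bind (g := readTallyBranch σ) h2) (ih (σ + 1))
    rw [List.length_cons, Nat.cast_add, Nat.cast_one, add_comm (w.length : ZMod p), ← add_assoc]
    exact h3.mono (by omega)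

/-- Write a bit on the temporary stack. -/
def writeBit (o : Option Bool) : Frag (Fin 6) (Unit ⊕ Unit) :=
  -- On a self-delimiting word a marker `true` is always followed by a bit, so the default is never
  -- used.
  instr (.push 3 (o.getD false) (.inl ()))

/-- Branching in `readWord`. -/
def readWordBranch : Option Bool → Frag (Fin 6) (Unit ⊕ Unit)
  | none => ret (.inr ())
  | some false => ret (.inr ())
  | some true => bind (instr (.pop 0 id)) writeBit

/-- Read a self-delimiting word from the input and write it, reversed, on the temporary stack. -/
def readWord : Frag (Fin 6) Unit :=
  loop (fun _ => bind (instr (.pop 0 id)) readWordBranch) ()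

theorem runs_readWord (w x c r t q a : List Bool) :
    readWord.Runs env (six (delimited w ++ x) c r t q a) () (six x c r (w.reverse ++ t) q a)
      (3 * w.length + 3) := by
  induction w generalizing t with
  | nil =>
    have h1 := runs_pop (env := env) (0 : Fin 6) id (six (false :: x) c r t q a)
    have h2 : (readWordBranch (some false)).Runs env (six x c r t q a) (.inr ())
      (six x c r t q a) 2 := runs_ret _ _
    simp only [update_six_zero, six_zero, List.tail_cons] at h1
    exact Runs.loop_exit (h1.bind (g := readWordBranch) h2)
  | cons b w ih =>
    have h1 := runs_pop (env := env) (0 : Fin 6) id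
      (six (true :: b :: (delimited w ++ x)) c r t q a)
    have h2 := runs_pop (env := env) (0 : Fin 6) id (six (b :: (delimited w ++ x)) c r t q a)
    have h3 := runs_push (env := env) (3 : Fin 6) b (Sum.inl () : Unit ⊕ Unit)
      (six (delimited w ++ x) c r t q a)
    simp only [update_six_zero, six_zero, List.tail_cons, update_six_three, six_three] at h1 h2 h3
    have h4 : (readWordBranch (some true)).Runs env (six (b :: (delimited w ++ x)) c r t q a)
        (.inl ()) (six (delimited w ++ x) c r (b :: t) q a) 2 :=
      h2.bind (g := writeBit) h3
    have h5 := Runs.loop_next (σ := ()) (h1.bind (g := readWordBranch) h4) (ih (b :: t))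
    simp only [List.reverse_cons, List.append_assoc, List.singleton_append]
    exact h5.mono (by simp only [List.length_cons]; omega)

/-- Process one term of a quantum graph with a given coefficient. -/
def processTerm (σ : ZMod p) : Option (ZMod p) → Frag (Fin 6) (ZMod p ⊕ Unit)
  | none => (pushWord 0 (residueCode σ)).mapExit .inr
  | some c => readWord.seq <| (moveRev 3 4).seq <| (instr (.query ())).seq <|
      (tally 5 (0 : ZMod p)).mapExit fun r => .inl (σ + c * r)

/-- Read a quantum graph from the input and evaluate it with an oracle for graphs. -/
def processTerms (σ : ZMod p) : Frag (Fin 6) Unit :=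
  loop (fun σ => bind (readTally (0 : ZMod p)) (processTerm σ)) σ

/-- Linearity in the first argument: one oracle call per term, with the partial sum held in the
control. -/
theorem runs_processTerms {O : List Bool → Option (List Bool)} (f : FinGraph → ZMod p)
    (hO : ∀ G : FinGraph, O G.code = some (residueCode (f G))) (Gbar : QuantumGraph p)
    (σ : ZMod p) :
    (processTerms σ).Runs (sixEnv O) (six (QuantumGraph.code Gbar) [] [] [] [] []) ()
      (six (residueCode (σ + (Gbar.map fun t => t.1 * f t.2).sum)) [] [] [] [] [])
      ((5 * p + 30) * ((QuantumGraph.code Gbar).length + 1)) := by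
  induction Gbar generalizing σ with
  | nil =>
    have h1 := runs_readTally_nil (env := sixEnv O) (0 : ZMod p) [] [] [] [] []
    have h2 := (runs_pushWord (env := sixEnv O) (0 : Fin 6) (residueCode σ)
      (six [] [] [] [] [] [])).mapExit (Sum.inr : Unit → ZMod p ⊕ Unit)
    simp only [update_six_zero, six_zero, List.append_nil] at h2
    rw [List.map_nil, List.sum_nil, add_zero]
    have h3 := length_residueCode_le σ
    exact (Runs.loop_exit (h1.bind (g := processTerm σ) h2)).mono (by
      simp only [QuantumGraph.code, List.flatMap_nil, List.length_nil]
      omega)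
  | cons s Gbar ih =>
    obtain ⟨c, G⟩ := s
    have h1 := runs_readTally (env := sixEnv O) (residueCode c)
      (delimited G.code ++ (QuantumGraph.code Gbar)) [] [] [] [] [] (0 : ZMod p)
    rw [natCast_length_residueCode, zero_add] at h1
    have h2 := runs_readWord (env := sixEnv O) G.code (QuantumGraph.code Gbar) [] [] [] [] []
    have h3 := runs_moveRev (env := sixEnv O) (a := (3 : Fin 6)) (b := 4) (by decide)
      (six (QuantumGraph.code Gbar) [] [] (G.code.reverse ++ []) [] [])
    simp only [update_six_three, update_six_four, six_three, six_four, List.append_nil,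
      List.reverse_reverse, List.length_reverse] at h2 h3
    have h4 := runs_query_six (O := O) () (i := QuantumGraph.code Gbar) (c := []) (r := []) (t := [])
      (a := [])
      (hO G)
    have h5 := (runs_tally (env := sixEnv O) (5 : Fin 6) (0 : ZMod p)
      (six (QuantumGraph.code Gbar) [] [] [] [] (residueCode (f G)))).mapExit
        fun r => (Sum.inl (σ + c * r) : ZMod p ⊕ Unit)
    simp only [update_six_five, six_five, natCast_length_residueCode, zero_add] at h5
    have h6 := Runs.loop_next (h1.bind (g := processTerm σ) (h2.seq (h3.seq (h4.seq h5))))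
      (ih (σ + c * f G))
    have e : QuantumGraph.code ((c, G) :: Gbar) =
        delimited (residueCode c) ++ (delimited G.code ++ (QuantumGraph.code Gbar)) := by
      simp [QuantumGraph.code]
    rw [e, List.map_cons, List.sum_cons, ← add_assoc]
    refine h6.mono ?_
    have h7 := length_residueCode_le (f G)
    have h8 := length_residueCode_le c
    simp only [List.length_append, length_delimited]
    -- The two terminators of a term contribute `2 * (5 * p + 30)`, which covers the constant costs
    -- and the tally of the answer; the other bits pay for reading and moving.
    have h9 : (5 * p + 30) * (2 * (residueCode c).length + 1 + (2 * G.code.length + 1 +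
        (QuantumGraph.code Gbar).length) + 1) = (5 * p + 30) * (2 * (residueCode c).length + 2 * G.code.length) +
        2 * (5 * p + 30) + (5 * p + 30) * ((QuantumGraph.code Gbar).length + 1) := by ring
    have h10 : 30 * (2 * (residueCode c).length + 2 * G.code.length) ≤
        (5 * p + 30) * (2 * (residueCode c).length + 2 * G.code.length) :=
      Nat.mul_le_mul_right _ (by omega)
    omega

end Reading

end Frag

/-- This direction carries tractability from graphs to quantum graphs as inputs. The input stack is
empty once all terms are read and can receive the output. -/
theorem quantumHomsToQuantum_turingReduces_homsToQuantum (p : ℕ) [NeZero p]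
    (Hbar : QuantumGraph p) :
    (quantumHomsToQuantum p Hbar).TuringReduces (homsToQuantum p Hbar) := by
  let O := (homsToQuantum p Hbar).oracle
  refine ⟨(processTerms (0 : ZMod p)).toMachine 0 0 (sixEnv O).qry (sixEnv O).ans,
    (5 * (p : ℕ[X]) + 30) * (X + 1), fun Gbar : QuantumGraph p => ?_⟩
  have hrun := runs_processTerms (O := O) Hbar.homsFrom (homsToQuantum p Hbar).oracle_code Gbar 0
  rw [← update_nil_zero] at hrun
  have h := outputsWithin_toMachine 0 0 (y := (quantumHomsToQuantum p Hbar).sol Gbar) hrun (by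
    simp [quantumHomsToQuantum, QuantumGraph.homsFromQuantum, QuantumGraph.homsFrom,
      ← List.sum_map_mul_left, mul_assoc])
  simp only [eval_add, eval_mul, eval_ofNat, eval_X, eval_natCast, eval_one, Nat.cast_id]
  exact h

/-! ### Codes of disjoint unions with fixed graphs -/

namespace Frag

variable {env : OracleEnv (Fin 6)}

section DisjointUnion

/-- Branching in `readCode`. -/
def readCodeBranch : Option Bool → Frag (Fin 6) (Unit ⊕ Unit)
  | none => ret (.inr ())
  | some false => ret (.inr ())
  | some true => instr (.push 1 true (.inl ()))

/-- Separate the number of vertices from the adjacency bits of the input. -/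
def readCode : Frag (Fin 6) Unit :=
  (loop (fun _ => bind (instr (.pop 0 id)) readCodeBranch) ()).seq (moveRev 0 2)

theorem runs_readCode (n : ℕ) (w : List Bool) :
    readCode.Runs env (six (List.replicate n true ++ false :: w) [] [] [] [] []) ()
      (six [] (List.replicate n true) w.reverse [] [] []) (2 * n + 4 * w.length + 6) := by
  -- The accumulated vertex count `c` is generalized, since it grows during the induction.
  have key : ∀ c, (loop (fun _ => bind (instr (.pop 0 id)) readCodeBranch) ()).Runs env
      (six (List.replicate n true ++ false :: w) c [] [] [] []) ()
      (six w (List.replicate n true ++ c) [] [] [] []) (2 * n + 3) := by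
    induction n with
    | zero =>
      intro c
      have h1 := runs_pop (env := env) (0 : Fin 6) id (six (false :: w) c [] [] [] [])
      have h2 : (readCodeBranch (some false)).Runs env (six w c [] [] [] []) (.inr ())
        (six w c [] [] [] []) 2 := runs_ret _ _
      simp only [update_six_zero, six_zero, List.tail_cons] at h1
      exact Runs.loop_exit (h1.bind (g := readCodeBranch) h2)
    | succ n ih =>
      intro c
      have h1 := runs_pop (env := env) (0 : Fin 6) id
        (six (true :: (List.replicate n true ++ false :: w)) c [] [] [] [])
      have h2 : (readCodeBranch (some true)).Runs env
          (six (List.replicate n true ++ false :: w) c [] [] [] []) (.inl ())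
          (six (List.replicate n true ++ false :: w) (true :: c) [] [] [] []) 1 :=
        (runs_push _ _ _ _).congr (by simp)
      simp only [update_six_zero, six_zero, List.tail_cons] at h1
      have h3 := Runs.loop_next (σ := ()) (h1.bind (g := readCodeBranch) h2) (ih (true :: c))
      have e : List.replicate n true ++ true :: c = List.replicate (n + 1) true ++ c := by
        rw [List.replicate_succ', List.append_assoc, List.singleton_append]
      rw [e] at h3
      exact h3.mono (by omega)
  have h1 := key []
  have h2 := runs_moveRev (env := env) (a := (0 : Fin 6)) (b := 2) (by decide)
    (six w (List.replicate n true ++ []) [] [] [] [])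
  simp only [update_six_zero, update_six_two, six_zero, six_two, List.append_nil] at h1 h2
  exact (h1.seq h2).mono (by omega)

/-- Push the image of the contents of a stack on the query stack and restore the stack. -/
def copyTo (k : Fin 6) (h : Bool → Bool) : Frag (Fin 6) Unit :=
  (split k 3 4 h).seq (moveRev 3 k)

/-- Copying reverses a word, which is harmless for a unary one. The map `h` turns the vertex count
into the zeros in front of a row. -/
theorem runs_copyTo_one (h : Bool → Bool) (n : ℕ) (i r q a : List Bool) :
    (copyTo 1 h).Runs env (six i (List.replicate n true) r [] q a) ()
      (six i (List.replicate n true) r [] (List.replicate n (h true) ++ q) a) (9 * n + 6) := by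
  have h1 := runs_split (env := env) (a := (1 : Fin 6)) (b := 3) (c := 4) (by decide) (by decide)
    (by decide) h (six i (List.replicate n true) r [] q a)
  have h2 := runs_moveRev (env := env) (a := (3 : Fin 6)) (b := 1) (by decide)
    (six i [] r (List.replicate n true) (List.replicate n (h true) ++ q) a)
  simp only [update_six_one, update_six_three, update_six_four, six_one, six_three, six_four,
    List.append_nil, List.reverse_replicate, List.map_replicate, List.length_replicate] at h1 h2
  exact (h1.seq h2).mono (by omega)

/-- The reversal is intended: stack 2 holds the adjacency bits in reverse order. -/
theorem runs_copyTo_two (i c w q a : List Bool) :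
    (copyTo 2 id).Runs env (six i c w [] q a) () (six i c w [] (w.reverse ++ q) a)
      (9 * w.length + 6) := by
  have h1 := runs_split (env := env) (a := (2 : Fin 6)) (b := 3) (c := 4) (by decide) (by decide)
    (by decide) id (six i c w [] q a)
  have h2 := runs_moveRev (env := env) (a := (3 : Fin 6)) (b := 2) (by decide)
    (six i c [] w.reverse (w.reverse ++ q) a)
  simp only [update_six_two, update_six_three, update_six_four, six_two, six_three, six_four,
    List.append_nil, List.map_id, List.reverse_reverse, List.length_reverse] at h1 h2
  exact (h1.seq h2).mono (by omega)

/-- Push fixed words on the query stack, each preceded by as many zeros as there are vertices. -/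
def pushRows : List (List Bool) → Frag (Fin 6) Unit
  | [] => ret ()
  | w :: rows => (pushRows rows).seq ((pushWord 4 w).seq (copyTo 1 fun _ => false))

/-- The rows belong to a fixed graph, so `C` may depend on them but not on the number `n` of input
vertices. -/
theorem exists_runs_pushRows (rows : List (List Bool)) :
    ∃ C : ℕ, ∀ (n : ℕ) (i r q a : List Bool), (pushRows rows).Runs env
      (six i (List.replicate n true) r [] q a) ()
      (six i (List.replicate n true) r []
        ((rows.flatMap fun w => List.replicate n false ++ w) ++ q) a) (C * (n + 1)) := by
  induction rows with
  | nil => exact ⟨2, fun n i r q a => (runs_ret _ _).mono (by omega)⟩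
  | cons w rows ih =>
    obtain ⟨C, hC⟩ := ih
    refine ⟨C + w.length + 9, fun n i r q a => ?_⟩
    have h1 := hC n i r q a
    have h2 := runs_pushWord (env := env) (4 : Fin 6) w (six i (List.replicate n true) r []
      ((rows.flatMap fun w => List.replicate n false ++ w) ++ q) a)
    rw [update_six_four, six_four] at h2
    have h3 := runs_copyTo_one (env := env) (fun _ => false) n i r
      (w ++ ((rows.flatMap fun w => List.replicate n false ++ w) ++ q)) a
    rw [List.flatMap_cons, List.append_assoc, List.append_assoc]
    refine (h1.seq (h2.seq h3)).mono ?_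
    have h4 : (C + w.length + 9) * (n + 1) = C * (n + 1) + w.length * n + w.length + 9 * n + 9 := by
      ring
    omega

/-- Write the code of the disjoint union of the input graph and a fixed graph on the query
stack. -/
noncomputable def pushAddCode (F : FinGraph) : Frag (Fin 6) Unit :=
  (pushRows ((List.finRange F.n).map F.row)).seq <| (copyTo 2 id).seq <|
  (pushWord 4 (List.replicate F.n true ++ [false])).seq <| copyTo 1 id

/-- The word in `FinGraph.code_add` is written from its end. The working stacks are restored, ready
for the next disjoint union. -/
theorem exists_runs_pushAddCode (F : FinGraph) : ∃ C : ℕ, ∀ G : FinGraph,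
    (pushAddCode F).Runs env (six [] (List.replicate G.n true) G.adjBits.reverse [] [] []) ()
      (six [] (List.replicate G.n true) G.adjBits.reverse [] (G.add F).code [])
      (C * (G.code.length + 1)) := by
  obtain ⟨C, hC⟩ := exists_runs_pushRows (env := env) ((List.finRange F.n).map F.row)
  refine ⟨C + F.n + 20, fun G => ?_⟩
  have h1 := hC G.n [] G.adjBits.reverse [] []
  rw [List.append_nil, List.flatMap_map] at h1
  have h2 := runs_copyTo_two (env := env) [] (List.replicate G.n true) G.adjBits.reverse
    ((List.finRange F.n).flatMap fun i => List.replicate G.n false ++ F.row i) []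
  rw [List.reverse_reverse, List.length_reverse] at h2
  have h3 := runs_pushWord (env := env) (4 : Fin 6) (List.replicate F.n true ++ [false])
    (six [] (List.replicate G.n true) G.adjBits.reverse [] (G.adjBits ++
      (List.finRange F.n).flatMap fun i => List.replicate G.n false ++ F.row i) [])
  rw [update_six_four, six_four, List.append_assoc, List.singleton_append] at h3
  have h4 := runs_copyTo_one (env := env) id G.n [] G.adjBits.reverse
    (List.replicate F.n true ++ false :: (G.adjBits ++
      (List.finRange F.n).flatMap fun i => List.replicate G.n false ++ F.row i)) []
  rw [id_eq, ← FinGraph.code_add] at h4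
  refine (h1.seq (h2.seq (h3.seq h4))).mono ?_
  have h5 : G.code.length = G.n + (G.adjBits.length + 1) := by simp [FinGraph.code]
  have h6 : (C + F.n + 20) * (G.code.length + 1) = C * (G.n + 1) + C * (G.adjBits.length + 1) +
      F.n * (G.code.length + 1) + 20 * (G.code.length + 1) := by
    rw [h5]
    ring
  have h7 : F.n * 1 ≤ F.n * (G.code.length + 1) := Nat.mul_le_mul_left _ (by omega)
  simp only [List.length_append, List.length_replicate, List.length_singleton]
  omega

variable {p : ℕ} [NeZero p]

/-- Add up the oracle's answers for disjoint unions of the input graph with fixed graphs, and write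
the sum on the input stack. -/
noncomputable def evalSum : QuantumGraph p → ZMod p → Frag (Fin 6) Unit
  | [], σ => pushWord 0 (residueCode σ)
  | t :: Fbar, σ => (pushAddCode t.2).seq <| (instr (.query ())).seq <|
      bind (tally 5 (0 : ZMod p)) fun r => evalSum Fbar (σ + t.1 * r)

/-- `Fbar` is built into the program, one block per term, so `C` is uniform in the input `G`. -/
theorem exists_runs_evalSum {O : List Bool → Option (List Bool)} (f : FinGraph → ZMod p)
    (hO : ∀ G : FinGraph, O G.code = some (residueCode (f G))) (Fbar : QuantumGraph p) :
    ∃ C : ℕ, ∀ (G : FinGraph) (σ : ZMod p), (evalSum Fbar σ).Runs (sixEnv O)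
      (six [] (List.replicate G.n true) G.adjBits.reverse [] [] []) ()
      (six (residueCode (σ + (Fbar.map fun t => t.1 * f (G.add t.2)).sum))
        (List.replicate G.n true) G.adjBits.reverse [] [] [])
      (C * (G.code.length + 1)) := by
  induction Fbar with
  | nil =>
    refine ⟨p + 2, fun G σ => ?_⟩
    have h := runs_pushWord (env := sixEnv O) (0 : Fin 6) (residueCode σ)
      (six [] (List.replicate G.n true) G.adjBits.reverse [] [] [])
    rw [update_six_zero, six_zero, List.append_nil] at h
    rw [List.map_nil, List.sum_nil, add_zero]
    refine h.mono ?_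
    have h1 := length_residueCode_le σ
    have h2 : (p + 2) * 1 ≤ (p + 2) * (G.code.length + 1) := Nat.mul_le_mul_left _ (by omega)
    omega
  | cons t Fbar ih =>
    obtain ⟨C, hC⟩ := ih
    obtain ⟨D, hD⟩ := exists_runs_pushAddCode (env := sixEnv O) t.2
    refine ⟨C + D + 5 * p + 4, fun G σ => ?_⟩
    have h2 := runs_query_six (O := O) () (i := []) (c := List.replicate G.n true)
      (r := G.adjBits.reverse) (t := []) (a := []) (hO (G.add t.2))
    have h3 := runs_tally (env := sixEnv O) (5 : Fin 6) (0 : ZMod p)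
      (six [] (List.replicate G.n true) G.adjBits.reverse [] []
        (residueCode (f (G.add t.2))))
    rw [update_six_five, six_five, natCast_length_residueCode, zero_add] at h3
    have h4 := hC G (σ + t.1 * f (G.add t.2))
    rw [List.map_cons, List.sum_cons, ← add_assoc]
    refine ((hD G).seq (h2.seq (h3.bind (g := fun r => evalSum Fbar (σ + t.1 * r)) h4))).mono ?_
    have h5 := length_residueCode_le (f (G.add t.2))
    have h6 : (C + D + 5 * p + 4) * (G.code.length + 1) = C * (G.code.length + 1) +
      D * (G.code.length + 1) + (5 * p + 4) * (G.code.length + 1) := by ring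
    have h7 : (5 * p + 4) * 1 ≤ (5 * p + 4) * (G.code.length + 1) :=
      Nat.mul_le_mul_left _ (by omega)
    omega

end DisjointUnion

end Frag

/-! ### Assembly of the two assertions -/

/-- A count of homomorphisms that is a linear combination of counts of homomorphisms from disjoint
unions with fixed graphs reduces to the latter counts. -/
theorem homsTo_turingReduces_homsToQuantum {p : ℕ} [NeZero p] {H : FinGraph}
    {Hbar : QuantumGraph p} (Fbar : QuantumGraph p)
    (h : ∀ G : FinGraph,
      (G.homCount H : ZMod p) = (Fbar.map fun f => f.1 * Hbar.homsFrom (G.add f.2)).sum) :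
    (homsTo p H).TuringReduces (homsToQuantum p Hbar) := by
  let O := (homsToQuantum p Hbar).oracle
  obtain ⟨C, hC⟩ := exists_runs_evalSum (O := O) Hbar.homsFrom
    (homsToQuantum p Hbar).oracle_code Fbar
  refine ⟨(readCode.seq (evalSum Fbar (0 : ZMod p))).toMachine 0 0 (sixEnv O).qry (sixEnv O).ans,
    ((C : ℕ[X]) + 6) * (X + 1), fun G : FinGraph => ?_⟩
  have hrun := (runs_readCode (env := sixEnv O) G.n G.adjBits).seq (hC G 0)
  rw [← update_nil_zero] at hrun
  have hlen : G.code.length = G.n + (G.adjBits.length + 1) := by simp [FinGraph.code]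
  have hout := outputsWithin_toMachine 0 0 (y := (homsTo p H).sol G)
    (hrun.mono (T' := (C + 6) * (G.code.length + 1)) (by rw [add_mul]; omega)) (by
      rw [six_zero, zero_add, ← h]
      rfl)
  simp only [eval_add, eval_mul, eval_ofNat, eval_X, eval_natCast, eval_one, Nat.cast_id]
  exact hout

/-- `Hbar` is fixed, so induction on its terms combines a constant number of machines. -/
theorem polyTimeSolvable_homsToQuantum {p : ℕ} [NeZero p] {Hbar : QuantumGraph p}
    (h : ∀ t ∈ Hbar, (homsTo p t.2).PolyTimeSolvable) :
    (homsToQuantum p Hbar).PolyTimeSolvable := by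
  induction Hbar with
  | nil =>
    have e : homsToQuantum p [] =
        ⟨FinGraph, FinGraph.code, FinGraph.code_injective, fun _ => []⟩ := by
      simp [homsToQuantum, QuantumGraph.homsFrom, residueCode]
    rw [e]
    exact polyTimeSolvable_nil_output
  | cons t Hbar ih =>
    have h1 := polyTimeSolvable_linComb (hc := FinGraph.code_injective)
      (a := fun G => (G.homCount t.2 : ZMod p)) t.1 (h t List.mem_cons_self)
      (ih fun s hs => h s (List.mem_cons_of_mem _ hs))
    have e : homsToQuantum p (t :: Hbar) = ⟨FinGraph, FinGraph.code, FinGraph.code_injective,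
        fun G => residueCode (t.1 * (G.homCount t.2 : ZMod p) + QuantumGraph.homsFrom Hbar G)⟩ := by
      simp [homsToQuantum, QuantumGraph.homsFrom]
    rw [e]
    exact h1

/-- Transitivity of reductions. The bound for `P` limits the answers seen by the outer machine, the
bound for `Q` those seen by the subroutine. -/
theorem Problem.SharpModHard.of_turingReduces {p B : ℕ} {P Q : Problem} (hP : P.SharpModHard p)
    (hPQ : P.TuringReduces Q) (hPB : ∀ i, (P.sol i).length ≤ B)
    (hQB : ∀ i, (Q.sol i).length ≤ B) : Q.SharpModHard p := by
  intro f hf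
  refine (hP f hf).exists_solvesInPolyTime hPB (fun w a h => ?_) hPQ
  obtain ⟨i, -, rfl⟩ := Problem.exists_of_oracle_eq_some h
  exact hQB i

theorem theorem1 (p : ℕ) [Fact p.Prime] (Hbar : QuantumGraph p)
    (hcoeff : ∀ t ∈ Hbar, t.1 ≠ 0)
    (hreduced : ∀ t ∈ Hbar, t.2.OrderReduced p)
    (hiso : Hbar.Pairwise fun s t => ¬ s.2.Isomorphic t.2) :
    ((∃ t ∈ Hbar, (homsTo p t.2).SharpModHard p) →
      (homsToQuantum p Hbar).SharpModHard p ∧ (quantumHomsToQuantum p Hbar).SharpModHard p) ∧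
    ((∀ t ∈ Hbar, (homsTo p t.2).PolyTimeSolvable) →
      (homsToQuantum p Hbar).PolyTimeSolvable ∧ (quantumHomsToQuantum p Hbar).PolyTimeSolvable) := by
  constructor
  · rintro ⟨t, ht, hard⟩
    obtain ⟨Fbar, hF⟩ := Hbar.exists_homCount_eq_sum hcoeff hreduced hiso ht
    have h1 : (homsToQuantum p Hbar).SharpModHard p :=
      hard.of_turingReduces (homsTo_turingReduces_homsToQuantum Fbar hF)
        (fun _ => length_residueCode_le _) fun _ => length_residueCode_le _
    exact ⟨h1, h1.of_turingReduces (homsToQuantum_turingReduces_quantumHomsToQuantum p Hbar)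
      (fun _ => length_residueCode_le _) fun _ => length_residueCode_le _⟩
  · intro h
    have h1 := polyTimeSolvable_homsToQuantum h
    -- The oracle for graph inputs is replaced by a polynomial-time machine; the remaining oracle
    -- never answers, so its length bound is vacuous.
    exact ⟨h1, (quantumHomsToQuantum_turingReduces_homsToQuantum p Hbar).exists_solvesInPolyTime
      (B := p) (fun _ => length_residueCode_le _) (by simp) h1⟩
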